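/- For a group $G$, let $\mathrm{Comm}(G)$ denote its abstract commensurator: the group, under composition, of equivalence classes of isomorphisms $\varphi\colon H_1\to H_2$ between finite-index subgroups $H_1,H_2\le G$, where two isomorphisms are equivalent if they are both defined and equal on a common finite-index subgroup of $G$. A group has the unique root property if $x^n=y^n$ for some integer $n\ne 0$ implies $x=y$. A finitely generated group has solvable word problem if there is an algorithm that decides whether a given word in a fixed finite generating set and its inverses represents the identity. A surface group is the fundamental group of a connected surface of finite genus with finitely many punctures and boundary components, that is, a group isomorphic to one with a standard presentation $$\langle a_1,b_1,\dots,a_g,b_g,c_1,\dots,c_p \mid [a_1,b_1]\cdots[a_g,b_g]\,c_1\cdots c_p\rangle\quad (g,p\ge 0)$$ or $$\langle d_1,\dots,d_k,c_1,\dots,c_p \mid d_1^2\cdots d_k^2\,c_1\cdots c_p\rangle\quad (k\ge 1,\ p\ge 0).$$ Let $\Gamma$ be a finitely presented group with solvable word problem and the unique root property. Then every finitely generated subgroup of $\mathrm{Comm}(\Gamma)$ has solvable word problem. Moreover, if $\Gamma$ is a surface group, then every finitely generated subgroup of $\mathrm{Comm}(\Gamma)$ has solvable word problem. -/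

import Mathlib

universe u

/-- A virtual isomorphism of `G`: an isomorphism `dom ≃* cod` between two subgroups
of finite index of `G`. -/
structure VirtualIso (G : Type u) [Group G] where
  dom : Subgroup G
  cod : Subgroup G
  finiteIndex_dom : dom.FiniteIndex
  finiteIndex_cod : cod.FiniteIndex
  equiv : dom ≃* cod

namespace VirtualIso

variable {G : Type u} [Group G]

/-- A virtual isomorphism as a homomorphism from its domain to `G`. -/
def toHom (φ : VirtualIso G) : φ.dom →* G :=
  φ.cod.subtype.comp φ.equiv.toMonoidHom

/-- The subgroup `{x ∈ φ.dom | φ x ∈ L}`. -/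
def pre (φ : VirtualIso G) (L : Subgroup G) : Subgroup G :=
  (L.comap φ.toHom).map φ.dom.subtype

theorem mem_pre {φ : VirtualIso G} {L : Subgroup G} {x : G} :
    x ∈ φ.pre L ↔ ∃ h : x ∈ φ.dom, φ.toHom ⟨x, h⟩ ∈ L := by
  simp [pre]

theorem finiteIndex_pre (φ : VirtualIso G) (L : Subgroup G) (hL : L.FiniteIndex) :
    (φ.pre L).FiniteIndex := by
  have hd := φ.finiteIndex_dom
  have h1 : (L.comap φ.toHom).index ≠ 0 := by
    rw [Subgroup.index_comap]
    exact Subgroup.isFiniteRelIndex_of_finiteIndex.relIndex_ne_zero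
  refine ⟨?_⟩
  rw [pre, Subgroup.index_map_subtype]
  exact mul_ne_zero h1 hd.index_ne_zero

/-- The identity isomorphism of `G`. -/
def refl (G : Type u) [Group G] : VirtualIso G where
  dom := ⊤
  cod := ⊤
  finiteIndex_dom := inferInstance
  finiteIndex_cod := inferInstance
  equiv := MulEquiv.refl _

/-- The inverse isomorphism `cod ≃* dom`. -/
def symm (φ : VirtualIso G) : VirtualIso G where
  dom := φ.cod
  cod := φ.dom
  finiteIndex_dom := φ.finiteIndex_cod
  finiteIndex_cod := φ.finiteIndex_dom
  equiv := φ.equiv.symm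

theorem symm_toHom_toHom (φ : VirtualIso G) (x : φ.dom) (h : φ.toHom x ∈ φ.cod) :
    φ.symm.toHom ⟨φ.toHom x, h⟩ = x := by
  change ((φ.equiv.symm (φ.equiv x) : φ.dom) : G) = x
  simp

theorem symm_toHom_eq (φ : VirtualIso G) (x : φ.dom) (z : G) (h : z ∈ φ.cod)
    (e : z = φ.toHom x) : φ.symm.toHom ⟨z, h⟩ = x := by
  subst e
  exact symm_toHom_toHom φ x h

theorem toHom_mem (φ : VirtualIso G) (x : φ.dom) : φ.toHom x ∈ φ.cod :=
  (φ.equiv x).2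

theorem comp_aux (φ ψ : VirtualIso G) (x : ψ.pre φ.dom) (h₁ : (x : G) ∈ ψ.dom)
    (h₂ : ψ.toHom ⟨x, h₁⟩ ∈ φ.dom) :
    φ.toHom ⟨ψ.toHom ⟨x, h₁⟩, h₂⟩ ∈ φ.symm.pre ψ.cod :=
  mem_pre.2 ⟨φ.toHom_mem _, by
    rw [symm_toHom_toHom]; exact ψ.toHom_mem _⟩

/-- The composition `φ ∘ ψ`, defined on `{x ∈ ψ.dom | ψ x ∈ φ.dom}`; its image is
`{z ∈ φ.cod | φ⁻¹ z ∈ ψ.cod}`. -/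
def comp (φ ψ : VirtualIso G) : VirtualIso G where
  dom := ψ.pre φ.dom
  cod := φ.symm.pre ψ.cod
  finiteIndex_dom := ψ.finiteIndex_pre _ φ.finiteIndex_dom
  finiteIndex_cod := φ.symm.finiteIndex_pre _ ψ.finiteIndex_cod
  equiv :=
    { toFun := fun x =>
        ⟨φ.toHom ⟨ψ.toHom ⟨x, (mem_pre.1 x.2).1⟩, (mem_pre.1 x.2).2⟩,
          comp_aux φ ψ x _ _⟩
      invFun := fun z =>
        ⟨ψ.symm.toHom ⟨φ.symm.toHom ⟨z, (mem_pre.1 z.2).1⟩, (mem_pre.1 z.2).2⟩,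
          comp_aux ψ.symm φ.symm z _ _⟩
      left_inv := fun x => Subtype.ext
        (symm_toHom_eq ψ ⟨x, _⟩ _ _ (symm_toHom_toHom φ ⟨_, (mem_pre.1 x.2).2⟩ _))
      right_inv := fun z => Subtype.ext
        (symm_toHom_eq φ.symm ⟨z, _⟩ _ _
          (symm_toHom_toHom ψ.symm ⟨_, (mem_pre.1 z.2).2⟩ _))
      map_mul' := fun x y => Subtype.ext (by
        change φ.toHom _ = φ.toHom _ * φ.toHom _
        rw [← map_mul]
        congr 1
        apply Subtype.ext
        change ψ.toHom _ = ψ.toHom _ * ψ.toHom _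
        rw [← map_mul]
        rfl) }

theorem comp_toHom (φ ψ : VirtualIso G) (x : G) (h : x ∈ (φ.comp ψ).dom)
    (h₁ : x ∈ ψ.dom) (h₂ : ψ.toHom ⟨x, h₁⟩ ∈ φ.dom) :
    (φ.comp ψ).toHom ⟨x, h⟩ = φ.toHom ⟨ψ.toHom ⟨x, h₁⟩, h₂⟩ := rfl

/-- Two virtual isomorphisms are equivalent if they are both defined and equal on a
common subgroup of finite index of `G`. -/
def Equivalent (φ ψ : VirtualIso G) : Prop :=
  ∃ K : Subgroup G, K.FiniteIndex ∧ ∀ x ∈ K, ∃ (h₁ : x ∈ φ.dom) (h₂ : x ∈ ψ.dom),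
    φ.toHom ⟨x, h₁⟩ = ψ.toHom ⟨x, h₂⟩

instance setoid (G : Type u) [Group G] : Setoid (VirtualIso G) where
  r := Equivalent
  iseqv :=
    { refl := fun φ => ⟨φ.dom, φ.finiteIndex_dom, fun _ h => ⟨h, h, rfl⟩⟩
      symm := by
        rintro φ ψ ⟨K, hK, h⟩
        refine ⟨K, hK, fun x hx => ?_⟩
        obtain ⟨h₁, h₂, e⟩ := h x hx
        exact ⟨h₂, h₁, e.symm⟩
      trans := by
        rintro φ ψ χ ⟨K, hK, h⟩ ⟨L, hL, h'⟩
        refine ⟨K ⊓ L, inferInstance, fun x hx => ?_⟩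
        obtain ⟨h₁, h₂, e⟩ := h x hx.1
        obtain ⟨_, h₃, e'⟩ := h' x hx.2
        exact ⟨h₁, h₃, e.trans e'⟩ }

theorem comp_equivalent {φ φ' ψ ψ' : VirtualIso G} (hφ : φ ≈ φ') (hψ : ψ ≈ ψ') :
    φ.comp ψ ≈ φ'.comp ψ' := by
  obtain ⟨K, hK, h⟩ := hφ
  obtain ⟨L, hL, h'⟩ := hψ
  have hP := ψ.finiteIndex_pre K hK
  refine ⟨ψ.pre K ⊓ L, inferInstance, fun x hx => ?_⟩
  obtain ⟨h₁, h₂, e⟩ := h' x hx.2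
  obtain ⟨_, hk⟩ := mem_pre.1 hx.1
  obtain ⟨h₃, h₄, e'⟩ := h _ hk
  have h₅ : ψ'.toHom ⟨x, h₂⟩ ∈ φ'.dom := e ▸ h₄
  refine ⟨mem_pre.2 ⟨h₁, h₃⟩, mem_pre.2 ⟨h₂, h₅⟩, ?_⟩
  change φ.toHom ⟨ψ.toHom ⟨x, h₁⟩, h₃⟩ = φ'.toHom ⟨ψ'.toHom ⟨x, h₂⟩, h₅⟩
  exact e'.trans (congrArg φ'.toHom (Subtype.ext e))

theorem symm_equivalent {φ φ' : VirtualIso G} (hφ : φ ≈ φ') : φ.symm ≈ φ'.symm := by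
  obtain ⟨K, hK, h⟩ := hφ
  have hP := φ.symm.finiteIndex_pre K hK
  refine ⟨φ.symm.pre K, hP, fun z hz => ?_⟩
  obtain ⟨h₁, hk⟩ := mem_pre.1 hz
  obtain ⟨_, h₄, e⟩ := h _ hk
  have hz' : z = φ'.toHom ⟨_, h₄⟩ := by
    rw [← e]
    exact (symm_toHom_toHom φ.symm ⟨z, h₁⟩ _).symm
  have h₂ : z ∈ φ'.cod := hz' ▸ φ'.toHom_mem _
  refine ⟨h₁, h₂, ?_⟩
  have h₆ := symm_toHom_toHom φ' ⟨_, h₄⟩ (φ'.toHom_mem _)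
  simp only [← hz'] at h₆
  exact h₆.symm

end VirtualIso

/-- The abstract commensurator of `G`: equivalence classes of isomorphisms between
subgroups of finite index of `G`. -/
def Comm (G : Type u) [Group G] : Type u :=
  Quotient (VirtualIso.setoid G)

namespace Comm

open VirtualIso

/-- The commensurator represented by a virtual isomorphism. -/
def mk {G : Type u} [Group G] (φ : VirtualIso G) : Comm G :=
  Quotient.mk _ φ

/-- The group structure is composition: `[φ] * [ψ] = [φ ∘ ψ]`. -/
instance group (G : Type u) [Group G] : Group (Comm G) where
  mul := Quotient.map₂ VirtualIso.comp fun _ _ hφ _ _ hψ => comp_equivalent hφ hψ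
  one := mk (VirtualIso.refl G)
  inv := Quotient.map VirtualIso.symm fun _ _ h => symm_equivalent h
  mul_assoc := by
    rintro ⟨φ⟩ ⟨ψ⟩ ⟨χ⟩
    refine Quotient.sound ⟨((φ.comp ψ).comp χ).dom, VirtualIso.finiteIndex_dom _,
      fun x hx => ?_⟩
    obtain ⟨h₁, h₂⟩ := mem_pre.1 hx
    obtain ⟨h₃, h₄⟩ := mem_pre.1 h₂
    exact ⟨hx, mem_pre.2 ⟨mem_pre.2 ⟨h₁, h₃⟩, h₄⟩, rfl⟩
  one_mul := by
    rintro ⟨φ⟩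
    exact Quotient.sound ⟨φ.dom, φ.finiteIndex_dom,
      fun x hx => ⟨mem_pre.2 ⟨hx, Subgroup.mem_top _⟩, hx, rfl⟩⟩
  mul_one := by
    rintro ⟨φ⟩
    exact Quotient.sound ⟨φ.dom, φ.finiteIndex_dom,
      fun x hx => ⟨mem_pre.2 ⟨Subgroup.mem_top _, hx⟩, hx, rfl⟩⟩
  inv_mul_cancel := by
    rintro ⟨φ⟩
    refine Quotient.sound ⟨φ.dom, φ.finiteIndex_dom,
      fun x hx => ⟨mem_pre.2 ⟨hx, φ.toHom_mem _⟩, Subgroup.mem_top _, ?_⟩⟩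
    exact symm_toHom_toHom φ ⟨x, hx⟩ (φ.toHom_mem _)

theorem mk_eq_mk {G : Type u} [Group G] (φ ψ : VirtualIso G) :
    mk φ = mk ψ ↔ φ.Equivalent ψ :=
  Quotient.eq

theorem mk_mul_mk {G : Type u} [Group G] (φ ψ : VirtualIso G) :
    mk φ * mk ψ = mk (φ.comp ψ) :=
  rfl

theorem one_def (G : Type u) [Group G] : (1 : Comm G) = mk (VirtualIso.refl G) :=
  rfl

theorem mk_inv {G : Type u} [Group G] (φ : VirtualIso G) : (mk φ)⁻¹ = mk φ.symm :=
  rfl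

end Comm

/-- The element of `G` represented by a word in the letters `s i` (written `(i, true)`)
and their inverses (written `(i, false)`). -/
def wordEval {G : Type*} [Group G] {n : ℕ} (s : Fin n → G) (w : List (Fin n × Bool)) : G :=
  (w.map fun l => if l.2 then s l.1 else (s l.1)⁻¹).prod

/-- `G` is generated by finitely many elements for which it is decidable by an algorithm
whether a word in them and their inverses represents the identity of `G`. -/
def HasSolvableWordProblem (G : Type*) [Group G] : Prop :=
  ∃ (n : ℕ) (s : Fin n → G), Subgroup.closure (Set.range s) = ⊤ ∧
    ComputablePred fun w : List (Fin n × Bool) => wordEval s w = 1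

/-- If `x ^ n = y ^ n` for some integer `n ≠ 0`, then `x = y`. -/
def UniqueRootProperty (G : Type*) [Group G] : Prop :=
  ∀ (x y : G) (n : ℤ), n ≠ 0 → x ^ n = y ^ n → x = y

/-- The commutator `[x, y] = x y x⁻¹ y⁻¹`. -/
def commutatorWord {α : Type*} (x y : α) : FreeGroup α :=
  FreeGroup.of x * FreeGroup.of y * (FreeGroup.of x)⁻¹ * (FreeGroup.of y)⁻¹

/-- The word `[a₁, b₁] ⋯ [a_g, b_g] c₁ ⋯ c_p`. -/
def orientableRelator (g p : ℕ) : FreeGroup ((Fin g ⊕ Fin g) ⊕ Fin p) :=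
  (List.ofFn fun i : Fin g =>
    commutatorWord (Sum.inl (Sum.inl i)) (Sum.inl (Sum.inr i))).prod *
  (List.ofFn fun j : Fin p => FreeGroup.of (Sum.inr j)).prod

/-- The word `d₁² ⋯ d_k² c₁ ⋯ c_p`. -/
def nonorientableRelator (k p : ℕ) : FreeGroup (Fin k ⊕ Fin p) :=
  (List.ofFn fun i : Fin k => FreeGroup.of (Sum.inl i) ^ 2).prod *
  (List.ofFn fun j : Fin p => FreeGroup.of (Sum.inr j)).prod

/-- The fundamental group of the connected orientable surface of genus `g` with `p`
punctures and boundary components (in total):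
`⟨a₁, b₁, …, a_g, b_g, c₁, …, c_p | [a₁, b₁] ⋯ [a_g, b_g] c₁ ⋯ c_p⟩`. -/
abbrev OrientableSurfaceGroup (g p : ℕ) : Type :=
  PresentedGroup {orientableRelator g p}

/-- The fundamental group of the connected non-orientable surface of genus `k ≥ 1` (the
connected sum of `k` projective planes) with `p` punctures and boundary components
(in total): `⟨d₁, …, d_k, c₁, …, c_p | d₁² ⋯ d_k² c₁ ⋯ c_p⟩`. -/
abbrev NonorientableSurfaceGroup (k p : ℕ) : Type :=
  PresentedGroup {nonorientableRelator k p}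

/-- A surface group: the fundamental group of a connected surface of finite genus with
finitely many punctures and boundary components. -/
def IsSurfaceGroup (G : Type*) [Group G] : Prop :=
  (∃ g p : ℕ, Nonempty (G ≃* OrientableSurfaceGroup g p)) ∨
    ∃ k p : ℕ, 1 ≤ k ∧ Nonempty (G ≃* NonorientableSurfaceGroup k p)

/-! A product of commensurators is represented by a composite of virtual isomorphisms. Let `K` have
finite index and unique roots, and choose all representatives with domain and image inside `K`. If a
composite `φ` represents the identity, every `x` in its domain has a fixed power `x ^ m` with `m >
0`, so `φ x` and `x` are `m`-th roots in `K` of the same element and coincide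
(`toHom_eq_of_mk_eq_one`). Triviality thus means that `φ` is literally the identity on its domain.
The index of the domain is at most the product of the indices for the factors, and a pigeonhole on
cosets (`wordEval_mem_of_short`) reduces the check to words of length at most twice that bound. A
finite-state transducer evaluates each factor on words (`exists_represents`), so finitely many
instances of the word problem of `Γ` decide the question: this is
`hasSolvableWordProblem_of_subgroup_comm`. For the first claim `K` is all of `Γ`.

Surface groups may fail to have unique roots: in the Klein bottle group `q * p * q⁻¹ = p⁻¹` gives
`(p * q) ^ 2 = q ^ 2`. Hence only virtual unique roots are required. A surface group is either
finite or embeds in `SurfaceExtension ε r`, the group generated by letters `y`, `p`, `q` with the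
single relation `q * p * q⁻¹ = p ^ ε * r`, where `r` is a word in the `y`. It is a free group
extended by the integers, so free reduction solves its word problem.

For the roots, order the free group by the sign of the leading coefficient of the lowest nontrivial
term of its Magnus expansion. This order is invariant under conjugation, and under an automorphism
whose linear part is, up to smaller letters, an increasing map of the alphabet. The square of the
shift is of this kind when `p` is the largest letter (`exists_cone`). The subgroup of even exponents
thereby gets an invariant cone on a kernel with image in the integers, and unique roots follow
(`uniqueRootProperty_of_cone`). -/

section

open PowerSeries

/-! ### Power series in central variables over a noncommutative ring -/

namespace PowerSeries

variable {A B : Type*} [Ring A] [Ring B]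

/-- The unit `1 + aX` of the ring of power series. -/
noncomputable def onePlus (a : A) : (A⟦X⟧)ˣ where
  val := 1 + C a * X
  inv := mk fun n => (-a) ^ n
  val_inv := by
    ext n
    rw [add_mul, one_mul, mul_assoc, map_add, coeff_C_mul, coeff_mk]
    cases n with
    | zero => simp
    | succ n => simp [coeff_succ_X_mul, coeff_one, pow_succ']
  inv_val := by
    ext n
    rw [mul_add, mul_one, ← mul_assoc, map_add, coeff_mk]
    cases n with
    | zero => simp
    | succ n => simp [coeff_succ_mul_X, coeff_one, pow_succ]

@[simp]
theorem val_onePlus (a : A) : (onePlus a : A⟦X⟧) = 1 + C a * X := rfl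

/-- The homomorphism from power series in two central variables to power series in one
variable that identifies the variables. -/
noncomputable def diagonal : (A⟦X⟧)⟦X⟧ →+* A⟦X⟧ where
  toFun f := mk fun m => ∑ p ∈ Finset.HasAntidiagonal.antidiagonal m, coeff p.1 (coeff p.2 f)
  map_zero' := by ext; simp
  map_add' f g := by ext; simp [Finset.sum_add_distrib]
  map_one' := by
    ext m
    rw [coeff_mk, Finset.sum_eq_single (m, 0)]
    · simp
    · rintro ⟨i, j⟩ h hne
      rw [Finset.HasAntidiagonal.mem_antidiagonal] at h
      have : j ≠ 0 := by
        rintro rfl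
        exact hne (by simpa using h)
      simp [coeff_one, this]
    · simp
  map_mul' f g := by
    ext m
    simp only [coeff_mk, coeff_mul, map_sum, Finset.sum_mul_sum, Finset.sum_sigma']
    -- Both sides run over the same quadruples of exponents, grouped by variable on the left and by
    -- factor on the right; the bijection regroups them.
    refine Finset.sum_bij'
      (fun x _ => ⟨(x.2.2.1 + x.2.1.1, x.2.2.2 + x.2.1.2),
        ⟨(x.2.2.1, x.2.1.1), (x.2.2.2, x.2.1.2)⟩⟩)
      (fun x _ => ⟨(x.2.1.1 + x.2.2.1, x.2.1.2 + x.2.2.2),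
        ⟨(x.2.1.2, x.2.2.2), (x.2.1.1, x.2.2.1)⟩⟩) ?_ ?_ ?_ ?_ ?_
    · rintro ⟨⟨a, b⟩, ⟨⟨c, d⟩, ⟨e, f⟩⟩⟩ h
      simp only [Finset.mem_sigma, Finset.HasAntidiagonal.mem_antidiagonal] at h ⊢
      obtain ⟨h, rfl, rfl⟩ := h
      refine ⟨?_, by trivial⟩
      omega
    · rintro ⟨⟨a, b⟩, ⟨⟨c, d⟩, ⟨e, f⟩⟩⟩ h
      simp only [Finset.mem_sigma, Finset.HasAntidiagonal.mem_antidiagonal] at h ⊢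
      obtain ⟨h, rfl, rfl⟩ := h
      refine ⟨?_, by trivial⟩
      omega
    · rintro ⟨⟨a, b⟩, ⟨⟨c, d⟩, ⟨e, f⟩⟩⟩ h
      simp only [Finset.mem_sigma, Finset.HasAntidiagonal.mem_antidiagonal] at h
      obtain ⟨-, rfl, rfl⟩ := h
      rfl
    · rintro ⟨⟨a, b⟩, ⟨⟨c, d⟩, ⟨e, f⟩⟩⟩ h
      simp only [Finset.mem_sigma, Finset.HasAntidiagonal.mem_antidiagonal] at h
      obtain ⟨-, rfl, rfl⟩ := h
      rfl
    · rintro ⟨⟨a, b⟩, ⟨⟨c, d⟩, ⟨e, f⟩⟩⟩ h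
      rfl

theorem coeff_diagonal (f : (A⟦X⟧)⟦X⟧) (m : ℕ) :
    coeff m (diagonal f) = ∑ p ∈ Finset.HasAntidiagonal.antidiagonal m, coeff p.1 (coeff p.2 f) := by
  simp [diagonal]

theorem diagonal_C (a : A⟦X⟧) : diagonal (C a) = a := by
  ext m
  rw [coeff_diagonal, Finset.sum_eq_single (m, 0)]
  · simp
  · rintro ⟨i, j⟩ h hne
    rw [Finset.HasAntidiagonal.mem_antidiagonal] at h
    have : j ≠ 0 := by
      rintro rfl
      exact hne (by simpa using h)
    simp [coeff_C, this]
  · simp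

theorem diagonal_X : diagonal (X : (A⟦X⟧)⟦X⟧) = X := by
  ext m
  rw [coeff_diagonal]
  simp only [coeff_X]
  rcases m with _ | _ | m
  · simp
  · simp [Finset.Nat.antidiagonal_succ]
  · refine (Finset.sum_eq_zero ?_).trans (by simp)
    rintro ⟨i, j⟩ h
    rw [Finset.HasAntidiagonal.mem_antidiagonal] at h
    by_cases hj : j = 1
    · have : i ≠ 0 := by simp only at h; omega
      simp [hj, coeff_one, this]
    · simp [hj]

theorem constantCoeff_diagonal (f : (A⟦X⟧)⟦X⟧) :
    constantCoeff (diagonal f) = constantCoeff (constantCoeff f) := by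
  rw [← coeff_zero_eq_constantCoeff_apply, coeff_diagonal]
  simp

theorem map_onePlus (f : A →+* B) (a : A) :
    Units.map (PowerSeries.map f : A⟦X⟧ →* B⟦X⟧) (onePlus a) = onePlus (f a) := by
  ext1
  simp

end PowerSeries

/-! ### The Magnus homomorphism and substitutions -/

namespace Magnus

variable {α : Type*}

/-- The Magnus homomorphism from the free group to the units of the power series ring
over the ring of noncommutative polynomials; it maps `x` to `1 + xX`. -/
noncomputable def magnus : FreeGroup α →* ((MonoidAlgebra ℤ (FreeMonoid α))⟦X⟧)ˣ :=
  FreeGroup.lift fun x => onePlus (MonoidAlgebra.single (FreeMonoid.of x) 1)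

@[simp]
theorem magnus_of (x : α) :
    magnus (FreeGroup.of x) = onePlus (MonoidAlgebra.single (FreeMonoid.of x) (1 : ℤ)) := by
  simp [magnus]

theorem constantCoeff_magnus (g : FreeGroup α) :
    constantCoeff (magnus g : (MonoidAlgebra ℤ (FreeMonoid α))⟦X⟧) = 1 := by
  have h : (Units.map ((constantCoeff : _ →+* MonoidAlgebra ℤ (FreeMonoid α)) :
      (MonoidAlgebra ℤ (FreeMonoid α))⟦X⟧ →* MonoidAlgebra ℤ (FreeMonoid α))).comp
      (magnus (α := α)) = 1 := by
    ext x
    simp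
  simpa using congrArg Units.val (DFunLike.congr_fun h g)

/-- The coefficients of `(magnus g - 1) / X`. -/
noncomputable def magnusTail (g : FreeGroup α) : (MonoidAlgebra ℤ (FreeMonoid α))⟦X⟧ :=
  PowerSeries.mk fun n => coeff (n + 1) (magnus g : (MonoidAlgebra ℤ (FreeMonoid α))⟦X⟧)

theorem one_add_magnusTail (g : FreeGroup α) :
    1 + magnusTail g * X = (magnus g : (MonoidAlgebra ℤ (FreeMonoid α))⟦X⟧) := by
  ext1 n
  cases n with
  | zero => simpa using (constantCoeff_magnus g).symm
  | succ n => simp [magnusTail, coeff_succ_mul_X, coeff_one]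

/-- The product `(1 + aX)(1 + bX)` equals `1 + (a + b + aXb)X`, so linear parts add. -/
theorem constantCoeff_magnusTail_mul (g h : FreeGroup α) :
    constantCoeff (magnusTail (g * h)) =
      constantCoeff (magnusTail g) + constantCoeff (magnusTail h) := by
  have e : magnusTail (g * h) * X =
      (magnusTail g + magnusTail h + magnusTail g * X * magnusTail h) * X := by
    have := one_add_magnusTail (g * h)
    rw [magnus.map_mul, Units.val_mul, ← one_add_magnusTail g, ← one_add_magnusTail h] at this
    rw [← add_left_cancel_iff (a := (1 : (MonoidAlgebra ℤ (FreeMonoid α))⟦X⟧)), this]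
    noncomm_ring
  have := congrArg (coeff 1) e
  simpa [coeff_succ_mul_X] using this

theorem constantCoeff_magnusTail_of (x : α) :
    constantCoeff (magnusTail (FreeGroup.of x)) =
      MonoidAlgebra.single (FreeMonoid.of x) 1 := by
  rw [← coeff_zero_eq_constantCoeff_apply]
  simp [-coeff_zero_eq_constantCoeff, magnusTail, coeff_succ_mul_X, coeff_one]

/-- The substitution `x ↦ magnusTail (θ x)`. -/
noncomputable def polySubst (θ : FreeGroup α →* FreeGroup α) :
    MonoidAlgebra ℤ (FreeMonoid α) →ₐ[ℤ] (MonoidAlgebra ℤ (FreeMonoid α))⟦X⟧ :=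
  MonoidAlgebra.lift ℤ _ _ (FreeMonoid.lift fun x => magnusTail (θ (FreeGroup.of x)))

theorem polySubst_single (θ : FreeGroup α →* FreeGroup α) (x : α) :
    polySubst θ (MonoidAlgebra.single (FreeMonoid.of x) 1) =
      magnusTail (θ (FreeGroup.of x)) := by
  simp [polySubst]
  exact one_smul ℤ _

/-- The endomorphism of the power series ring induced by an endomorphism of the free
group. -/
noncomputable def seriesSubst (θ : FreeGroup α →* FreeGroup α) :
    (MonoidAlgebra ℤ (FreeMonoid α))⟦X⟧ →+* (MonoidAlgebra ℤ (FreeMonoid α))⟦X⟧ :=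
  -- Substituting in the coefficients creates a second central variable; the diagonal merges it with
  -- the original `X`, which keeps track of the degree.
  diagonal.comp (PowerSeries.map (polySubst θ : _ →+* _))

theorem seriesSubst_magnus (θ : FreeGroup α →* FreeGroup α) (g : FreeGroup α) :
    seriesSubst θ (magnus g : (MonoidAlgebra ℤ (FreeMonoid α))⟦X⟧) = magnus (θ g) := by
  have h : (Units.map (seriesSubst θ : _ →* _)).comp (magnus (α := α)) =
      magnus.comp θ := by
    ext1 x
    ext1
    simp [seriesSubst, diagonal_C, diagonal_X, polySubst_single, one_add_magnusTail]
  simpa using congrArg Units.val (DFunLike.congr_fun h g)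

theorem seriesSubst_X (θ : FreeGroup α →* FreeGroup α) : seriesSubst θ X = X := by
  simp [seriesSubst, diagonal_X]

/-- The substitution `x ↦ [θ x]`, where `[g]` is the linear part of `magnus g`. -/
noncomputable def linearSubst (θ : FreeGroup α →* FreeGroup α) :
    MonoidAlgebra ℤ (FreeMonoid α) →+* MonoidAlgebra ℤ (FreeMonoid α) :=
  constantCoeff.comp (polySubst θ : _ →+* _)

/-- At `X = 0` only the linear parts of the `θ x` survive. Hence `θ` acts on the lowest term of a
Magnus expansion through `linearSubst` alone. -/
theorem constantCoeff_seriesSubst (θ : FreeGroup α →* FreeGroup α)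
    (f : (MonoidAlgebra ℤ (FreeMonoid α))⟦X⟧) :
    constantCoeff (seriesSubst θ f) = linearSubst θ (constantCoeff f) := by
  simp only [seriesSubst, linearSubst, constantCoeff_diagonal, RingHom.comp_apply]
  rw [← coeff_zero_eq_constantCoeff_apply (PowerSeries.map _ f), coeff_map]
  simp

theorem linearSubst_single (θ : FreeGroup α →* FreeGroup α) (x : α) :
    linearSubst θ (MonoidAlgebra.single (FreeMonoid.of x) 1) =
      constantCoeff (magnusTail (θ (FreeGroup.of x))) := by
  simp [linearSubst, polySubst_single]

end Magnus

end

section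

open PowerSeries

namespace Magnus

/-! ### Leading words of noncommutative polynomials -/

section LeadingTerms

variable {α : Type*}

/-- The noncommutative monomial given by a word. -/
noncomputable def word (w : List α) : MonoidAlgebra ℤ (FreeMonoid α) :=
  MonoidAlgebra.single (FreeMonoid.ofList w) 1

theorem word_nil : word ([] : List α) = 1 := rfl

theorem word_append (v w : List α) : word (v ++ w) = word v * word w := by
  simp [word, MonoidAlgebra.single_mul_single, FreeMonoid.ofList_append]

theorem coeff_word_of_ne {v w : List α} (h : v ≠ w) :
    (word v).coeff (FreeMonoid.ofList w) = 0 := by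
  classical
  rw [word, MonoidAlgebra.coeff_single, Finsupp.single_apply, if_neg]
  simpa using h

theorem coeff_word_self (w : List α) : (word w).coeff (FreeMonoid.ofList w) = 1 := by
  simp [word, MonoidAlgebra.coeff_single]

theorem eq_sum_word (a : MonoidAlgebra ℤ (FreeMonoid α)) :
    a = ∑ s ∈ a.coeff.support, a.coeff s • word (FreeMonoid.toList s) := by
  conv_lhs => rw [← MonoidAlgebra.sum_coeff_single a]
  refine Finset.sum_congr rfl fun s _ => ?_
  simp [word, MonoidAlgebra.smul_single]

variable [LinearOrder α]

/-- The span of the words that have the same length as `w` and are smaller. -/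
noncomputable def lowerSpan (w : List α) : AddSubgroup (MonoidAlgebra ℤ (FreeMonoid α)) :=
  AddSubgroup.closure (word '' {s | s.length = w.length ∧ s < w})

/-- `a` is the sum of the word `w` and smaller words of the same length. -/
def HasLead (w : List α) (a : MonoidAlgebra ℤ (FreeMonoid α)) : Prop :=
  a - word w ∈ lowerSpan w

theorem coeff_eq_zero_of_mem_lowerSpan {w u : List α} (h : w ≤ u)
    {a : MonoidAlgebra ℤ (FreeMonoid α)} (ha : a ∈ lowerSpan w) :
    a.coeff (FreeMonoid.ofList u) = 0 := by
  induction ha using AddSubgroup.closure_induction with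
  | mem x hx =>
    obtain ⟨s, hs, rfl⟩ := hx
    exact coeff_word_of_ne (hs.2.trans_le h).ne
  | zero => simp
  | add x y _ _ hx hy => simp [hx, hy]
  | neg x _ hx => simp [hx]

theorem HasLead.coeff_self {w : List α} {a : MonoidAlgebra ℤ (FreeMonoid α)}
    (h : HasLead w a) : a.coeff (FreeMonoid.ofList w) = 1 := by
  have := coeff_eq_zero_of_mem_lowerSpan le_rfl h
  simp only [MonoidAlgebra.coeff_sub, Finsupp.sub_apply, coeff_word_self] at this
  omega

theorem HasLead.coeff_of_lt {w u : List α} {a : MonoidAlgebra ℤ (FreeMonoid α)}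
    (h : HasLead w a) (hu : w < u) : a.coeff (FreeMonoid.ofList u) = 0 := by
  have := coeff_eq_zero_of_mem_lowerSpan hu.le h
  simp only [MonoidAlgebra.coeff_sub, Finsupp.sub_apply, coeff_word_of_ne hu.ne] at this
  omega

/-- Words of equal length differ first at a position inside both, so what is appended does not
matter. Without equal length this fails for prefixes, which is why `lowerSpan` fixes the length. -/
theorem append_lt_append_of_length_eq {s w : List α} (hl : s.length = w.length)
    (h : s < w) (t t' : List α) : s ++ t < w ++ t' := by
  induction s generalizing w with
  | nil =>
    cases w with
    | nil => exact absurd h (lt_irrefl _)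
    | cons b w => simp at hl
  | cons a s ih =>
    cases w with
    | nil => simp at hl
    | cons b w =>
      rw [List.cons_lt_cons_iff] at h
      rw [List.cons_append, List.cons_append, List.cons_lt_cons_iff]
      rcases h with h | ⟨rfl, h⟩
      · exact Or.inl h
      · exact Or.inr ⟨rfl, ih (by simpa using hl) h⟩

theorem lowerSpan_mul_word {w t t' : List α} (hl : t.length = t'.length)
    {a : MonoidAlgebra ℤ (FreeMonoid α)} (ha : a ∈ lowerSpan w) :
    a * word t ∈ lowerSpan (w ++ t') := by
  induction ha using AddSubgroup.closure_induction with
  | mem x hx =>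
    obtain ⟨s, hs, rfl⟩ := hx
    rw [← word_append]
    exact AddSubgroup.subset_closure ⟨_, ⟨by simp [hs.1, hl],
      append_lt_append_of_length_eq hs.1 hs.2 _ _⟩, rfl⟩
  | zero => simp [zero_mem]
  | add x y _ _ hx hy => rw [add_mul]; exact add_mem hx hy
  | neg x _ hx => rw [neg_mul]; exact neg_mem hx

theorem word_mul_lowerSpan {w t : List α} {a : MonoidAlgebra ℤ (FreeMonoid α)}
    (ha : a ∈ lowerSpan t) : word w * a ∈ lowerSpan (w ++ t) := by
  induction ha using AddSubgroup.closure_induction with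
  | mem x hx =>
    obtain ⟨s, hs, rfl⟩ := hx
    rw [← word_append]
    exact AddSubgroup.subset_closure ⟨_, ⟨by simp [hs.1], List.append_left_lt hs.2⟩, rfl⟩
  | zero => simp [zero_mem]
  | add x y _ _ hx hy => rw [mul_add]; exact add_mem hx hy
  | neg x _ hx => rw [mul_neg]; exact neg_mem hx

theorem lowerSpan_mul_lowerSpan {w t : List α} {a b : MonoidAlgebra ℤ (FreeMonoid α)}
    (ha : a ∈ lowerSpan w) (hb : b ∈ lowerSpan t) : a * b ∈ lowerSpan (w ++ t) := by
  induction hb using AddSubgroup.closure_induction with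
  | mem x hx =>
    obtain ⟨s, hs, rfl⟩ := hx
    exact lowerSpan_mul_word hs.1 ha
  | zero => simp [zero_mem]
  | add x y _ _ hx hy => rw [mul_add]; exact add_mem hx hy
  | neg x _ hx => rw [mul_neg]; exact neg_mem hx

theorem HasLead.mul {w t : List α} {a b : MonoidAlgebra ℤ (FreeMonoid α)}
    (ha : HasLead w a) (hb : HasLead t b) : HasLead (w ++ t) (a * b) := by
  have e : a * b - word (w ++ t) = (a - word w) * (b - word t) + (a - word w) * word t +
      word w * (b - word t) := by
    rw [word_append]
    noncomm_ring
  rw [HasLead, e]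
  exact add_mem (add_mem (lowerSpan_mul_lowerSpan ha hb) (lowerSpan_mul_word rfl ha))
    (word_mul_lowerSpan hb)

theorem hasLead_map {T : MonoidAlgebra ℤ (FreeMonoid α) →+* MonoidAlgebra ℤ (FreeMonoid α)}
    {κ : α → α} (hT : ∀ x, HasLead [κ x] (T (word [x]))) (w : List α) :
    HasLead (w.map κ) (T (word w)) := by
  induction w with
  | nil => simp [HasLead, word_nil, zero_mem]
  | cons x w ih =>
    have := (hT x).mul ih
    rwa [← map_mul, ← word_append] at this

/-- The coefficient of the largest word of `a` is positive. -/
def LeadPos (a : MonoidAlgebra ℤ (FreeMonoid α)) : Prop :=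
  ∃ w : List α, 0 < a.coeff (FreeMonoid.ofList w) ∧
    ∀ u, w < u → a.coeff (FreeMonoid.ofList u) = 0

theorem not_leadPos_zero : ¬ LeadPos (0 : MonoidAlgebra ℤ (FreeMonoid α)) := by
  rintro ⟨w, h, -⟩
  simp at h

theorem LeadPos.add {a b : MonoidAlgebra ℤ (FreeMonoid α)} (ha : LeadPos a)
    (hb : LeadPos b) : LeadPos (a + b) := by
  obtain ⟨v, hv, hv'⟩ := ha
  obtain ⟨w, hw, hw'⟩ := hb
  rcases lt_trichotomy v w with h | rfl | h
  · refine ⟨w, ?_, fun u hu => ?_⟩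
    · simpa [hv' w h] using hw
    · simp [hv' u (h.trans hu), hw' u hu]
  · refine ⟨v, ?_, fun u hu => ?_⟩
    · simpa using add_pos hv hw
    · simp [hv' u hu, hw' u hu]
  · refine ⟨v, ?_, fun u hu => ?_⟩
    · simpa [hw' v h] using hv
    · simp [hw' u (h.trans hu), hv' u hu]

theorem leadPos_or_leadPos_neg {a : MonoidAlgebra ℤ (FreeMonoid α)} (ha : a ≠ 0) :
    LeadPos a ∨ LeadPos (-a) := by
  classical
  have hs : (a.coeff.support.image FreeMonoid.toList).Nonempty := by
    rw [Finset.image_nonempty, Finsupp.support_nonempty_iff]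
    intro h
    apply ha
    ext s
    simp [h]
  set w := (a.coeff.support.image FreeMonoid.toList).max' hs with hw
  have hmem := Finset.max'_mem _ hs
  rw [← hw, Finset.mem_image] at hmem
  obtain ⟨s, hs', hsw⟩ := hmem
  have hne : a.coeff (FreeMonoid.ofList w) ≠ 0 := by
    rw [← hsw]
    simpa using hs'
  have hlt : ∀ u, w < u → a.coeff (FreeMonoid.ofList u) = 0 := by
    intro u hu
    by_contra h
    refine absurd (Finset.le_max' (a.coeff.support.image FreeMonoid.toList) u ?_) (not_le.2 hu)
    rw [Finset.mem_image]
    exact ⟨FreeMonoid.ofList u, by simpa using h, rfl⟩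
  rcases lt_or_gt_of_ne hne with h | h
  · exact Or.inr ⟨w, by simpa using h, fun u hu => by simp [hlt u hu]⟩
  · exact Or.inl ⟨w, h, hlt⟩

/-- Each word `s` of `a` becomes `s.map κ` plus smaller words, and `List.map κ` is strictly
increasing. So the image of the largest word receives no contribution from the others and keeps its
coefficient. -/
theorem LeadPos.map {T : MonoidAlgebra ℤ (FreeMonoid α) →+* MonoidAlgebra ℤ (FreeMonoid α)}
    {κ : α → α} (hκ : StrictMono κ) (hT : ∀ x, HasLead [κ x] (T (word [x])))
    {a : MonoidAlgebra ℤ (FreeMonoid α)} (ha : LeadPos a) : LeadPos (T a) := by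
  have hmono : StrictMono (List.map κ) := by
    intro v w h
    induction v generalizing w with
    | nil =>
      cases w with
      | nil => exact absurd h (lt_irrefl _)
      | cons b w => simp
    | cons x v ih =>
      cases w with
      | nil => simp at h
      | cons b w =>
        rw [List.cons_lt_cons_iff] at h
        rw [List.map_cons, List.map_cons, List.cons_lt_cons_iff]
        rcases h with h | ⟨rfl, h⟩
        · exact Or.inl (hκ h)
        · exact Or.inr ⟨rfl, ih h⟩
  have key : ∀ u, (T a).coeff u = ∑ s ∈ a.coeff.support,
      a.coeff s * (T (word (FreeMonoid.toList s))).coeff u := by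
    intro u
    conv_lhs => rw [eq_sum_word a]
    simp only [map_sum, map_zsmul, MonoidAlgebra.coeff_sum, MonoidAlgebra.coeff_smul,
      Finsupp.finsetSum_apply, Finsupp.smul_apply, smul_eq_mul]
  obtain ⟨w, hw, hw'⟩ := ha
  have hle : ∀ s ∈ a.coeff.support, FreeMonoid.toList s ≤ w := by
    intro s hs
    by_contra h
    exact Finsupp.mem_support_iff.1 hs (hw' _ (not_le.1 h))
  refine ⟨w.map κ, ?_, fun u hu => ?_⟩
  · rw [key, Finset.sum_eq_single (FreeMonoid.ofList w)]
    · have := (hasLead_map hT w).coeff_self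
      simpa [this] using hw
    · intro s hs hne
      have hlt : FreeMonoid.toList s < w := lt_of_le_of_ne (hle s hs) fun h => hne (by simp [← h])
      rw [(hasLead_map hT _).coeff_of_lt (hmono hlt), mul_zero]
    · intro h
      simp [Finsupp.notMem_support_iff.1 h]
  · rw [key]
    refine Finset.sum_eq_zero fun s hs => ?_
    rw [(hasLead_map hT _).coeff_of_lt ((hmono.monotone (hle s hs)).trans_lt hu), mul_zero]

end LeadingTerms

/-! ### Injectivity of the Magnus homomorphism -/

section Injectivity

variable {α : Type*}

open Classical in
/-- The operator that adds the letter `x` in front of a word, or maps the word to zero if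
it begins with `x`. -/
noncomputable def prepend (x : α) : Module.End ℤ (List α →₀ ℤ) :=
  Finsupp.linearCombination ℤ fun w : List α =>
    if w.head? = some x then 0 else Finsupp.single (x :: w) (1 : ℤ)

theorem prepend_single {x : α} {w : List α} (h : w.head? ≠ some x) (c : ℤ) :
    prepend x (Finsupp.single w c) = Finsupp.single (x :: w) c := by
  simp [prepend, h]

/-- The result of `prepend x` begins with `x` and is killed the second time. Square zero makes
`onePlus (prepend x) ^ n` linear in `n`, so a whole syllable contributes a single factor. -/
theorem prepend_mul_self (x : α) : prepend x * prepend x = 0 := by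
  classical
  refine Finsupp.lhom_ext fun w c => ?_
  by_cases h : w.head? = some x
  · simp [prepend, h]
  · simp [prepend, h]

theorem onePlus_mul_onePlus {A : Type*} [Ring A] {a b : A} (h : a * b = 0) :
    onePlus a * onePlus b = onePlus (a + b) := by
  ext1
  have e : C a * X * (C b * X) = (0 : A⟦X⟧) := by
    rw [mul_assoc, ← mul_assoc X, X_mul, mul_assoc, ← mul_assoc (C a), ← map_mul, h]
    simp
  simp only [Units.val_mul, val_onePlus, map_add]
  rw [add_mul, mul_add, mul_add, e, one_mul, mul_one, add_zero, one_mul, add_mul]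
  abel

theorem onePlus_zpow {A : Type*} [Ring A] {a : A} (h : a * a = 0) (n : ℤ) :
    onePlus a ^ n = onePlus (n • a) := by
  have h0 : onePlus (0 : A) = 1 := by ext1; simp
  have hn : ∀ m : ℕ, onePlus a ^ m = onePlus (m • a) := by
    intro m
    induction m with
    | zero => simp [h0]
    | succ m ih =>
      rw [pow_succ, ih, onePlus_mul_onePlus (by rw [smul_mul_assoc, h, smul_zero]), succ_nsmul]
  cases n with
  | ofNat m => simpa using hn m
  | negSucc m =>
    rw [zpow_negSucc, hn, _root_.inv_eq_iff_mul_eq_one, onePlus_mul_onePlus, negSucc_zsmul,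
      add_neg_cancel, h0]
    rw [negSucc_zsmul, mul_neg, smul_mul_assoc, mul_smul_comm, h]
    simp

/-- The composition of `magnus` with `prepend`, on the free product of infinite cyclic
groups. -/
noncomputable def syllableHom :
    Monoid.CoprodI (fun _ : α => FreeGroup Unit) →* ((Module.End ℤ (List α →₀ ℤ))⟦X⟧)ˣ :=
  Monoid.CoprodI.lift fun x => FreeGroup.lift fun _ => onePlus (prepend x)

theorem syllableHom_of {x : α} {m : FreeGroup Unit} (hm : m ≠ 1) :
    ∃ n : ℤ, n ≠ 0 ∧ syllableHom (Monoid.CoprodI.of (i := x) m) = onePlus (n • prepend x) := by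
  have e : m = FreeGroup.of () ^ FreeGroup.freeGroupUnitEquivInt m :=
    (FreeGroup.freeGroupUnitEquivInt.symm_apply_apply m).symm
  refine ⟨FreeGroup.freeGroupUnitEquivInt m, fun h => hm ?_, ?_⟩
  · rw [e, h, zpow_zero]
  · conv_lhs => rw [e]
    rw [map_zpow, map_zpow, syllableHom, Monoid.CoprodI.lift_of, FreeGroup.lift_apply_of,
      onePlus_zpow (prepend_mul_self x)]

/-- The list `l` records the letters of the syllables and `c` is the product of their nonzero
exponents. Adjacent syllables have different letters, so no `prepend` in the top term vanishes on
the empty word. -/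
theorem exists_coeff_syllableHom_prod (w : Monoid.CoprodI.Word fun _ : α => FreeGroup Unit) :
    ∃ (l : List α) (c : ℤ), c ≠ 0 ∧ l.head? = w.fstIdx ∧
      (∀ j, l.length < j → coeff j (syllableHom w.prod : (Module.End ℤ (List α →₀ ℤ))⟦X⟧) = 0) ∧
      coeff l.length (syllableHom w.prod : (Module.End ℤ (List α →₀ ℤ))⟦X⟧)
        (Finsupp.single [] 1) = Finsupp.single l c := by
  induction w using Monoid.CoprodI.Word.consRecOn with
  | empty =>
    refine ⟨[], 1, one_ne_zero, rfl, fun j hj => ?_, ?_⟩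
    · have : j ≠ 0 := by rintro rfl; simp at hj
      simp [coeff_one, this]
    · simp
  | cons i m w h1 h2 ih =>
    obtain ⟨l, c, hc, hl, h0, htop⟩ := ih
    obtain ⟨n, hn, e⟩ := syllableHom_of (x := i) h2
    have hsucc : ∀ j, coeff (j + 1) (syllableHom (Monoid.CoprodI.Word.cons (i := i) m w h1 h2).prod :
        (Module.End ℤ (List α →₀ ℤ))⟦X⟧) = coeff (j + 1) (syllableHom w.prod :
        (Module.End ℤ (List α →₀ ℤ))⟦X⟧) + n • prepend i * coeff j (syllableHom w.prod :
        (Module.End ℤ (List α →₀ ℤ))⟦X⟧) := by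
      intro j
      rw [Monoid.CoprodI.Word.prod_cons, map_mul, e, Units.val_mul, val_onePlus, add_mul, one_mul,
        mul_assoc, map_add, coeff_C_mul, coeff_succ_X_mul]
    refine ⟨i :: l, n * c, mul_ne_zero hn hc, by simp, fun j hj => ?_, ?_⟩
    · obtain ⟨j, rfl⟩ : ∃ k, j = k + 1 := ⟨j - 1, by simp at hj; omega⟩
      simp only [List.length_cons, add_lt_add_iff_right] at hj
      rw [hsucc, h0 _ hj, h0 _ (hj.trans (Nat.lt_succ_self j))]
      simp
    · rw [List.length_cons, hsucc, h0 _ (Nat.lt_succ_self _), zero_add]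
      rw [← hl] at h1
      simp [htop, prepend_single h1]

theorem magnus_injective : Function.Injective (magnus (α := α)) := by
  rw [injective_iff_map_eq_one]
  intro g hg
  let F : MonoidAlgebra ℤ (FreeMonoid α) →+* Module.End ℤ (List α →₀ ℤ) :=
    (MonoidAlgebra.lift ℤ _ _ (FreeMonoid.lift prepend) : _ →ₐ[ℤ] _).toRingHom
  have hF : (Units.map (PowerSeries.map F : (MonoidAlgebra ℤ (FreeMonoid α))⟦X⟧ →*
      (Module.End ℤ (List α →₀ ℤ))⟦X⟧)).comp magnus =
      syllableHom.comp (freeGroupEquivCoprodI (ι := α)).toMonoidHom := by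
    ext1 x
    have : F (MonoidAlgebra.single (FreeMonoid.of x) 1) = prepend x := by
      simp only [F, AlgHom.toRingHom_eq_coe, RingHom.coe_coe, MonoidAlgebra.lift_single,
        FreeMonoid.lift_eval_of]
      exact one_smul ℤ _
    simp [freeGroupEquivCoprodI, syllableHom, map_onePlus, this]
  have h1 : syllableHom (freeGroupEquivCoprodI g) = 1 := by
    have := DFunLike.congr_fun hF g
    simpa [hg] using this.symm
  classical
  obtain ⟨w, hw⟩ := Monoid.CoprodI.Word.equiv.symm.surjective (freeGroupEquivCoprodI g)
  have hw : w.prod = freeGroupEquivCoprodI g := hw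
  obtain ⟨l, c, hc, hl, -, htop⟩ := exists_coeff_syllableHom_prod w
  rw [hw, h1] at htop
  have hl0 : l = [] := by
    by_contra h
    have : l.length ≠ 0 := by simpa using h
    rw [Units.val_one, coeff_one, if_neg this, LinearMap.zero_apply, eq_comm,
      Finsupp.single_eq_zero] at htop
    exact hc htop
  have hwe : w = Monoid.CoprodI.Word.empty := by
    ext1
    rw [hl0] at hl
    simpa [Monoid.CoprodI.Word.fstIdx, eq_comm] using hl
  rw [hwe, Monoid.CoprodI.Word.prod_empty] at hw
  exact (map_eq_one_iff _ (freeGroupEquivCoprodI (ι := α)).injective).1 hw.symm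

end Injectivity

/-! ### The Magnus order of a free group -/

section PositiveCone

variable {α : Type*} [LinearOrder α]

/-- The positive cone of the Magnus order of the free group. -/
def IsPos (g : FreeGroup α) : Prop :=
  ∃ (d : ℕ) (q : (MonoidAlgebra ℤ (FreeMonoid α))⟦X⟧), 0 < d ∧
    (magnus g : (MonoidAlgebra ℤ (FreeMonoid α))⟦X⟧) = 1 + X ^ d * q ∧
      LeadPos (constantCoeff q)

theorem not_isPos_one : ¬ IsPos (1 : FreeGroup α) := by
  rintro ⟨d, q, -, h, hq⟩
  rw [map_one, Units.val_one, left_eq_add] at h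
  have := congrArg (coeff d) h
  rw [coeff_X_pow_mul', if_pos le_rfl, Nat.sub_self, coeff_zero_eq_constantCoeff_apply,
    map_zero] at this
  exact not_leadPos_zero (this ▸ hq)

theorem constantCoeff_X_pow_mul {A : Type*} [Ring A] {d : ℕ} (hd : 0 < d) (q : A⟦X⟧) :
    constantCoeff (X ^ d * q) = 0 := by
  simp [hd.ne']

/-- The lowest term of the product is that of the factor with smaller exponent, or the sum of both
when the exponents agree. -/
theorem IsPos.mul {g h : FreeGroup α} (hg : IsPos g) (hh : IsPos h) : IsPos (g * h) := by
  obtain ⟨d, q, hd, eg, hq⟩ := hg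
  obtain ⟨e, r, he, eh, hr⟩ := hh
  have hX : X ^ e * (q * r) = q * (X ^ e * r) := by
    rw [← mul_assoc, ← mul_assoc, X_pow_mul]
  have hprod : (magnus (g * h) : (MonoidAlgebra ℤ (FreeMonoid α))⟦X⟧) =
      1 + X ^ d * (q + X ^ e * (q * r)) + X ^ e * r := by
    rw [map_mul, Units.val_mul, eg, eh, hX]
    noncomm_ring
  rcases lt_trichotomy d e with hlt | rfl | hlt
  · obtain ⟨k, rfl⟩ := Nat.exists_eq_add_of_lt hlt
    refine ⟨d, q + X ^ (d + k + 1) * (q * r) + X ^ (k + 1) * r, hd, ?_, ?_⟩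
    · rw [hprod, add_assoc d, pow_add X d (k + 1)]
      noncomm_ring
    · rw [map_add, map_add, constantCoeff_X_pow_mul he,
        constantCoeff_X_pow_mul (Nat.succ_pos k), add_zero, add_zero]
      exact hq
  · refine ⟨d, q + X ^ d * (q * r) + r, hd, ?_, ?_⟩
    · rw [hprod, mul_add _ _ r, add_assoc]
    · rw [map_add, map_add, constantCoeff_X_pow_mul hd, add_zero]
      exact hq.add hr
  · obtain ⟨k, rfl⟩ := Nat.exists_eq_add_of_lt hlt
    refine ⟨e, X ^ (k + 1) * (q + X ^ e * (q * r)) + r, he, ?_, ?_⟩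
    · rw [hprod, add_assoc e, pow_add X e (k + 1)]
      noncomm_ring
    · rw [map_add, constantCoeff_X_pow_mul (Nat.succ_pos k), zero_add]
      exact hr

/-- The series of `h` and `h⁻¹` have constant coefficient `1`, so conjugation leaves the lowest term
unchanged. -/
theorem IsPos.conj {g : FreeGroup α} (hg : IsPos g) (h : FreeGroup α) :
    IsPos (h * g * h⁻¹) := by
  obtain ⟨d, q, hd, e, hq⟩ := hg
  refine ⟨d, magnus h * q * ((magnus h)⁻¹ : ((MonoidAlgebra ℤ (FreeMonoid α))⟦X⟧)ˣ), hd, ?_, ?_⟩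
  · rw [map_mul, map_mul, map_inv, Units.val_mul, Units.val_mul, e, mul_add, mul_one, add_mul,
      Units.mul_inv, ← mul_assoc, ← X_pow_mul, mul_assoc, mul_assoc, mul_assoc]
  · rw [← map_inv, map_mul, map_mul, constantCoeff_magnus, constantCoeff_magnus, one_mul, mul_one]
    exact hq

theorem isPos_or_isPos_inv {g : FreeGroup α} (hg : g ≠ 1) : IsPos g ∨ IsPos g⁻¹ := by
  classical
  have hne : ∃ n, coeff n ((magnus g : (MonoidAlgebra ℤ (FreeMonoid α))⟦X⟧) - 1) ≠ 0 := by
    by_contra! h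
    refine hg (magnus_injective ?_)
    ext1
    rw [map_one, Units.val_one, ← sub_eq_zero]
    exact PowerSeries.ext h
  have hd : Nat.find hne ≠ 0 := by
    intro h
    have := Nat.find_spec hne
    rw [h, coeff_zero_eq_constantCoeff_apply, map_sub, constantCoeff_magnus, map_one,
      sub_self] at this
    exact this rfl
  set d := Nat.find hne with hdef
  set q : (MonoidAlgebra ℤ (FreeMonoid α))⟦X⟧ := PowerSeries.mk fun k =>
    coeff (d + k) ((magnus g : (MonoidAlgebra ℤ (FreeMonoid α))⟦X⟧) - 1) with hq
  have e : (magnus g : (MonoidAlgebra ℤ (FreeMonoid α))⟦X⟧) = 1 + X ^ d * q := by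
    rw [← sub_eq_iff_eq_add']
    ext1 n
    rw [coeff_X_pow_mul']
    split_ifs with h
    · rw [hq, coeff_mk, Nat.add_sub_cancel' h]
    · exact not_not.1 (Nat.find_min hne (not_le.1 h))
  have hq0 : constantCoeff q ≠ 0 := by
    rw [← coeff_zero_eq_constantCoeff_apply, hq, coeff_mk]
    exact Nat.find_spec hne
  rcases leadPos_or_leadPos_neg hq0 with h | h
  · exact Or.inl ⟨d, q, Nat.pos_of_ne_zero hd, e, h⟩
  -- With `M = magnus g`, the witness comes from `M⁻¹ - 1 = -(M - 1) * M⁻¹`.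
  · refine Or.inr ⟨d, -(q * magnus g⁻¹), Nat.pos_of_ne_zero hd, ?_, ?_⟩
    · have : (magnus g : (MonoidAlgebra ℤ (FreeMonoid α))⟦X⟧) * magnus g⁻¹ = 1 := by
        rw [map_inv, Units.mul_inv]
      have h2 : X ^ d * q = (magnus g : (MonoidAlgebra ℤ (FreeMonoid α))⟦X⟧) - 1 := by
        rw [e, add_sub_cancel_left]
      rw [mul_neg, ← mul_assoc, h2, sub_mul, this, one_mul]
      abel
    · rw [map_neg, map_mul, constantCoeff_magnus, mul_one]
      exact h

theorem IsPos.map {θ : FreeGroup α →* FreeGroup α} {κ : α → α} (hκ : StrictMono κ)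
    (hθ : ∀ x, HasLead [κ x] (constantCoeff (magnusTail (θ (FreeGroup.of x)))))
    {g : FreeGroup α} (hg : IsPos g) : IsPos (θ g) := by
  obtain ⟨d, q, hd, e, hq⟩ := hg
  refine ⟨d, seriesSubst θ q, hd, ?_, ?_⟩
  · rw [← seriesSubst_magnus, e, map_add, map_mul, map_pow, seriesSubst_X, map_one]
  · rw [constantCoeff_seriesSubst]
    refine hq.map hκ fun x => ?_
    have := linearSubst_single θ x
    exact this.symm ▸ hθ x

end PositiveCone

end Magnus

end

/-! ### Virtual unique roots -/

section

open PowerSeries Magnus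

/-- A group has the unique root property if it maps to the integers and the kernel carries
an order that is invariant under conjugation by the whole group. -/
theorem uniqueRootProperty_of_cone {G : Type*} [Group G] (π : G →* Multiplicative ℤ)
    (P : G → Prop) (one : ¬ P 1) (mul : ∀ x y, P x → P y → P (x * y))
    (conj : ∀ x y, P x → P (y * x * y⁻¹)) (total : ∀ x, π x = 1 → x ≠ 1 → P x ∨ P x⁻¹) :
    UniqueRootProperty G := by
  have key : ∀ (x y : G), P (y * x⁻¹) → ∀ m : ℕ, P (y ^ (m + 1) * (x ^ (m + 1))⁻¹) := by
    intro x y h m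
    induction m with
    | zero => simpa using h
    | succ m ih =>
      -- A conjugate of the previous quotient times `y * x⁻¹`: both factors lie in the cone.
      have e : y ^ (m + 1 + 1) * (x ^ (m + 1 + 1))⁻¹ =
          y * (y ^ (m + 1) * (x ^ (m + 1))⁻¹) * y⁻¹ * (y * x⁻¹) := by
        rw [pow_succ' y (m + 1), pow_succ' x (m + 1)]
        group
      rw [e]
      exact mul _ _ (conj _ _ ih) h
  have nat : ∀ (x y : G) (m : ℕ), x ^ (m + 1) = y ^ (m + 1) → x = y := by
    intro x y m h
    -- The integers are torsion-free, so `y * x⁻¹` lies in the kernel, where the cone is total.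
    have hπ : π x = π y := by
      have := congrArg (fun z => Multiplicative.toAdd (π z)) h
      simp only [map_pow, toAdd_pow] at this
      have := smul_right_injective ℤ (Nat.succ_ne_zero m) this
      exact Multiplicative.toAdd.injective this
    by_contra hne
    have h1 : y * x⁻¹ ≠ 1 := fun h => hne (mul_inv_eq_one.1 h).symm
    rcases total (y * x⁻¹) (by rw [map_mul, map_inv, hπ, mul_inv_cancel]) h1 with h2 | h2
    · have := key x y h2 m
      rw [h, mul_inv_cancel] at this
      exact one this
    · rw [mul_inv_rev, inv_inv] at h2
      have := key y x h2 m
      rw [h, mul_inv_cancel] at this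
      exact one this
  intro x y n hn h
  obtain ⟨m, rfl | rfl⟩ := n.eq_nat_or_neg
  · obtain ⟨k, rfl⟩ := Nat.exists_eq_succ_of_ne_zero (by simpa using hn : m ≠ 0)
    exact nat x y k (by exact_mod_cast h)
  · obtain ⟨k, rfl⟩ := Nat.exists_eq_succ_of_ne_zero (by simpa using hn : m ≠ 0)
    rw [zpow_neg, zpow_neg, inv_inj] at h
    exact nat x y k (by exact_mod_cast h)

/-- `G` has a subgroup of finite index with the unique root property. -/
def VirtualUniqueRoots (G : Type*) [Group G] : Prop :=
  ∃ K : Subgroup G, K.FiniteIndex ∧ UniqueRootProperty K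

theorem UniqueRootProperty.of_injective {G H : Type*} [Group G] [Group H] (f : G →* H)
    (hf : Function.Injective f) (h : UniqueRootProperty H) : UniqueRootProperty G := by
  intro x y n hn e
  refine hf (h _ _ n hn ?_)
  rw [← map_zpow, e, map_zpow]

theorem UniqueRootProperty.virtualUniqueRoots {G : Type*} [Group G]
    (h : UniqueRootProperty G) : VirtualUniqueRoots G :=
  ⟨⊤, inferInstance, h.of_injective (Subgroup.subtype _) (Subgroup.subtype_injective _)⟩

theorem VirtualUniqueRoots.of_injective {G H : Type*} [Group G] [Group H] (f : G →* H)
    (hf : Function.Injective f) (h : VirtualUniqueRoots H) : VirtualUniqueRoots G := by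
  obtain ⟨K, hK, hr⟩ := h
  refine ⟨K.comap f, ⟨?_⟩, hr.of_injective (f.subgroupComap K) fun x y e =>
    ?_⟩
  swap
  · exact Subtype.ext (hf (congrArg Subtype.val e))
  rw [Subgroup.index_comap]
  exact Subgroup.isFiniteRelIndex_of_finiteIndex.relIndex_ne_zero

theorem VirtualUniqueRoots.of_finite {G : Type*} [Group G] [Finite G] : VirtualUniqueRoots G :=
  ⟨⊥, inferInstance, fun _ _ _ _ _ => Subsingleton.elim _ _⟩

/-! ### The shift extension and its invariant cone -/

namespace SurfaceExtension

variable {Y : Type*}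

/-- The letters of level `i`, for an integer `i`. -/
def level (i : ℤ) : FreeGroup Y →* FreeGroup (Option (Y × ℤ)) :=
  FreeGroup.map fun y => some (y, i)

theorem level_of (i : ℤ) (y : Y) :
    level i (FreeGroup.of y) = FreeGroup.of (some (y, i)) := by
  simp [level]

/-- The images of the letters under the shift. -/
def shiftLetter (ε : ℤˣ) (r : FreeGroup Y) :
    Option (Y × ℤ) → FreeGroup (Option (Y × ℤ))
  | some (y, i) => FreeGroup.of (some (y, i + 1))
  | none => FreeGroup.of none ^ (ε : ℤ) * level 0 r

/-- The images of the letters under the inverse of the shift. -/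
def unshiftLetter (ε : ℤˣ) (r : FreeGroup Y) :
    Option (Y × ℤ) → FreeGroup (Option (Y × ℤ))
  | some (y, i) => FreeGroup.of (some (y, i - 1))
  | none => (FreeGroup.of none * (level (-1) r)⁻¹) ^ (ε : ℤ)

theorem lift_shiftLetter_level (ε : ℤˣ) (r g : FreeGroup Y) (i : ℤ) :
    FreeGroup.lift (shiftLetter ε r) (level i g) = level (i + 1) g := by
  have : (FreeGroup.lift (shiftLetter ε r)).comp (level i) = level (i + 1) := by
    ext y
    simp [level_of, shiftLetter]
  exact DFunLike.congr_fun this g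

theorem lift_unshiftLetter_level (ε : ℤˣ) (r g : FreeGroup Y) (i : ℤ) :
    FreeGroup.lift (unshiftLetter ε r) (level i g) = level (i - 1) g := by
  have : (FreeGroup.lift (unshiftLetter ε r)).comp (level i) = level (i - 1) := by
    ext y
    simp [level_of, unshiftLetter]
  exact DFunLike.congr_fun this g

theorem zpow_unit_zpow_unit {G : Type*} [Group G] (g : G) (ε : ℤˣ) :
    (g ^ (ε : ℤ)) ^ (ε : ℤ) = g := by
  rw [← zpow_mul, ← Units.val_mul, Int.units_mul_self]
  simp

/-- The automorphism of the free group that raises the level of the letters by one and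
maps the remaining letter `p` to `p ^ ε * r`. -/
def shift (ε : ℤˣ) (r : FreeGroup Y) : MulAut (FreeGroup (Option (Y × ℤ))) :=
  MonoidHom.toMulEquiv (FreeGroup.lift (shiftLetter ε r)) (FreeGroup.lift (unshiftLetter ε r))
    (by
      ext1 (_ | ⟨y, i⟩)
      · simp only [MonoidHom.comp_apply, FreeGroup.lift_apply_of, shiftLetter, map_mul, map_zpow,
          lift_unshiftLetter_level, unshiftLetter, zpow_unit_zpow_unit, MonoidHom.id_apply]
        simp
      · simp [shiftLetter, unshiftLetter])
    (by
      ext1 (_ | ⟨y, i⟩)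
      · simp only [MonoidHom.comp_apply, FreeGroup.lift_apply_of, shiftLetter, map_mul, map_zpow,
          map_inv, lift_shiftLetter_level, unshiftLetter, MonoidHom.id_apply]
        simp [zpow_unit_zpow_unit]
      · simp [shiftLetter, unshiftLetter])

theorem shift_apply (ε : ℤˣ) (r : FreeGroup Y) (g : FreeGroup (Option (Y × ℤ))) :
    shift ε r g = FreeGroup.lift (shiftLetter ε r) g := rfl

theorem shift_of_some (ε : ℤˣ) (r : FreeGroup Y) (y : Y) (i : ℤ) :
    shift ε r (FreeGroup.of (some (y, i))) = FreeGroup.of (some (y, i + 1)) := by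
  simp [shift_apply, shiftLetter]

theorem shift_level (ε : ℤˣ) (r g : FreeGroup Y) (i : ℤ) :
    shift ε r (level i g) = level (i + 1) g :=
  lift_shiftLetter_level ε r g i

theorem shift_of_none (ε : ℤˣ) (r : FreeGroup Y) :
    shift ε r (FreeGroup.of none) = FreeGroup.of none ^ (ε : ℤ) * level 0 r := by
  simp [shift_apply, shiftLetter]

/-- The linear part of `magnus`. -/
noncomputable def linearPart {α : Type*} :
    FreeGroup α →* Multiplicative (MonoidAlgebra ℤ (FreeMonoid α)) where
  toFun g := Multiplicative.ofAdd (constantCoeff (magnusTail g))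
  map_one' := by
    have := constantCoeff_magnusTail_mul (1 : FreeGroup α) 1
    rw [mul_one, left_eq_add] at this
    rw [this]
    rfl
  map_mul' g h := by
    rw [constantCoeff_magnusTail_mul]
    rfl

theorem linearPart_of {α : Type*} (x : α) :
    linearPart (FreeGroup.of x) = Multiplicative.ofAdd (word [x]) :=
  congrArg Multiplicative.ofAdd (constantCoeff_magnusTail_of x)

/-- Letters are compared by level first and then by an arbitrary well-order of `Y`, so translating
levels is monotone. The letter `none` is put on top so that the factor `r`, which involves only the
other letters, cannot affect the leading word. -/
theorem exists_linearOrder (Y : Type*) : ∃ _ : LinearOrder (Option (Y × ℤ)),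
    (∀ x : Y × ℤ, some x < none) ∧
      StrictMono (Option.map fun x : Y × ℤ => (x.1, x.2 + 2)) := by
  let _ : LinearOrder Y := IsWellOrder.linearOrder WellOrderingRel
  let f : Option (Y × ℤ) → WithTop (ℤ ×ₗ Y) := fun o =>
    o.elim ⊤ fun x => ((toLex (x.2, x.1) : ℤ ×ₗ Y) : WithTop (ℤ ×ₗ Y))
  have hf : Function.Injective f := by
    rintro (_ | ⟨y, i⟩) (_ | ⟨z, j⟩) h
    · rfl
    · simp [f] at h
    · simp [f] at h
    · simp only [f, Option.elim_some, WithTop.coe_inj, toLex_inj, Prod.mk.injEq] at h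
      rw [h.1, h.2]
  refine ⟨LinearOrder.lift' f hf, fun x => ?_, ?_⟩
  · change f (some x) < f none
    exact WithTop.coe_lt_top _
  · intro a b h
    change f a < f b at h
    change f _ < f _
    rcases a with _ | ⟨y, i⟩ <;> rcases b with _ | ⟨z, j⟩
    · exact absurd h (lt_irrefl _)
    · simp [f] at h
    · exact WithTop.coe_lt_top _
    · simp only [f, Option.map_some, Option.elim_some, WithTop.coe_lt_coe, Prod.Lex.toLex_lt_toLex,
        add_lt_add_iff_right, add_left_inj] at h ⊢
      exact h

/-- The free group has a positive cone that is invariant under conjugation and under the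
square of the shift. -/
theorem exists_cone (ε : ℤˣ) (r : FreeGroup Y) : ∃ P : FreeGroup (Option (Y × ℤ)) → Prop,
    ¬ P 1 ∧ (∀ x y, P x → P y → P (x * y)) ∧ (∀ x y, P x → P (y * x * y⁻¹)) ∧
      (∀ x, x ≠ 1 → P x ∨ P x⁻¹) ∧ ∀ (x) (k : ℤ), P x → P ((shift ε r ^ (2 * k)) x) := by
  obtain ⟨_, hlt, hmono⟩ := exists_linearOrder Y
  have hlow : ∀ (i : ℤ) (g : FreeGroup Y),
      Multiplicative.toAdd (linearPart (level i g)) ∈ lowerSpan [(none : Option (Y × ℤ))] := by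
    intro i g
    induction g using FreeGroup.induction_on with
    | C1 => simp [zero_mem]
    | of y =>
      rw [level_of, linearPart_of]
      exact AddSubgroup.subset_closure
        ⟨[some (y, i)], ⟨rfl, List.cons_lt_cons_iff.2 (Or.inl (hlt (y, i)))⟩, rfl⟩
    | inv_of y h =>
      rw [map_inv, map_inv, toAdd_inv]
      exact neg_mem h
    | mul x y hx hy =>
      rw [map_mul, map_mul, toAdd_mul]
      exact add_mem hx hy
  -- For `ε = -1` the shift itself sends the top letter to minus itself plus smaller letters;
  -- squaring restores the sign because `ε * ε = 1`.
  have hpos : ∀ x, IsPos x → IsPos ((shift ε r ^ 2) x) := by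
    intro x hx
    refine hx.map (θ := (shift ε r ^ 2 : MulAut _).toMonoidHom) hmono ?_
    rintro (_ | ⟨y, i⟩)
    · have e : (shift ε r ^ 2) (FreeGroup.of none) =
          (FreeGroup.of none ^ (ε : ℤ) * level 0 r) ^ (ε : ℤ) * level 1 r := by
        rw [pow_two, MulAut.mul_apply, shift_of_none, map_mul, map_zpow, shift_of_none,
          shift_level, zero_add]
      have e' : constantCoeff (magnusTail ((shift ε r ^ 2) (FreeGroup.of none))) =
          word [none] + ((ε : ℤ) • Multiplicative.toAdd (linearPart (level 0 r)) +
            Multiplicative.toAdd (linearPart (level 1 r))) := by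
        change Multiplicative.toAdd (linearPart _) = _
        rw [e]
        simp only [map_mul, map_zpow, linearPart_of, toAdd_mul, toAdd_zpow, toAdd_ofAdd, smul_add,
          smul_smul, ← Units.val_mul, Int.units_mul_self, Units.val_one, one_smul, add_assoc]
      change HasLead [none] (constantCoeff (magnusTail ((shift ε r ^ 2) (FreeGroup.of none))))
      rw [HasLead, e', add_sub_cancel_left]
      exact add_mem (zsmul_mem (hlow 0 r) _) (hlow 1 r)
    · change HasLead [some (y, i + 2)]
        (constantCoeff (magnusTail ((shift ε r ^ 2) (FreeGroup.of (some (y, i))))))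
      rw [pow_two, MulAut.mul_apply, shift_of_some, shift_of_some, constantCoeff_magnusTail_of,
        add_assoc]
      change word _ - word _ ∈ _
      rw [show (1 : ℤ) + 1 = 2 from rfl, sub_self]
      exact zero_mem _
  -- Totality gives the inverse: otherwise the inverse of the preimage would be positive, hence also
  -- `x⁻¹`.
  have hneg : ∀ x, IsPos x → IsPos ((shift ε r ^ 2)⁻¹ x) := by
    intro x hx
    have h1 : (shift ε r ^ 2) ((shift ε r ^ 2)⁻¹ x) = x := MulAut.apply_inv_self _ _ _
    have hne : (shift ε r ^ 2)⁻¹ x ≠ 1 := by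
      intro h
      rw [h, map_one] at h1
      exact not_isPos_one (h1 ▸ hx)
    rcases isPos_or_isPos_inv hne with h | h
    · exact h
    · have := hpos _ h
      rw [map_inv, h1] at this
      exact absurd (mul_inv_cancel x ▸ hx.mul this) not_isPos_one
  refine ⟨IsPos, not_isPos_one, fun _ _ => IsPos.mul, fun _ y h => h.conj y,
    fun _ => isPos_or_isPos_inv, fun x k hx => ?_⟩
  rw [zpow_mul]
  induction k using Int.induction_on with
  | zero => simpa using hx
  | succ k ih =>
    rw [add_comm, zpow_add, zpow_one, MulAut.mul_apply]
    exact hpos _ ih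
  | pred k ih =>
    rw [sub_eq_neg_add, zpow_add, zpow_neg_one, MulAut.mul_apply]
    exact hneg _ ih

end SurfaceExtension

/-- The extension of the free group by the integers given by the shift. The conjugate of
the letter `p` by the generator of the integers is `p ^ ε * r`. -/
abbrev SurfaceExtension {Y : Type*} (ε : ℤˣ) (r : FreeGroup Y) : Type _ :=
  FreeGroup (Option (Y × ℤ)) ⋊[zpowersHom _ (SurfaceExtension.shift ε r)] Multiplicative ℤ

namespace SurfaceExtension

variable {Y : Type*}

theorem virtualUniqueRoots (ε : ℤˣ) (r : FreeGroup Y) :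
    VirtualUniqueRoots (SurfaceExtension ε r) := by
  obtain ⟨P, one, mul, conj, total, hs⟩ := exists_cone ε r
  -- The parity of the exponent. Its kernel acts on the free group through conjugations and powers
  -- of the squared shift, all of which preserve the cone.
  let f : SurfaceExtension ε r →* Multiplicative (ZMod 2) :=
    (AddMonoidHom.toMultiplicative (Int.castAddHom (ZMod 2))).comp SemidirectProduct.rightHom
  have hf : ∀ x : f.ker, ∃ k : ℤ, (x : SurfaceExtension ε r).right =
      Multiplicative.ofAdd (2 * k) := by
    rintro ⟨x, hx⟩
    have : ((Multiplicative.toAdd x.right : ℤ) : ZMod 2) = 0 := hx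
    rw [ZMod.intCast_zmod_eq_zero_iff_dvd] at this
    obtain ⟨k, hk⟩ := this
    exact ⟨k, Multiplicative.toAdd.injective hk⟩
  refine ⟨f.ker, inferInstance, uniqueRootProperty_of_cone
    (SemidirectProduct.rightHom.comp f.ker.subtype)
    (fun x => (x : SurfaceExtension ε r).right = 1 ∧ P (x : SurfaceExtension ε r).left)
    ?_ ?_ ?_ ?_⟩
  · rintro ⟨-, h⟩
    exact one h
  · rintro x y ⟨hx, hx'⟩ ⟨hy, hy'⟩
    refine ⟨by simp [hx, hy], ?_⟩
    simpa [hx] using mul _ _ hx' hy'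
  · rintro x y ⟨hx, hx'⟩
    refine ⟨by simp [hx], ?_⟩
    obtain ⟨k, hk⟩ := hf y
    have := conj _ (y : SurfaceExtension ε r).left (hs _ k hx')
    simp only [Subgroup.coe_mul, Subgroup.coe_inv, SemidirectProduct.mul_left,
      SemidirectProduct.mul_right, SemidirectProduct.inv_left, hx, hk, mul_one, map_inv,
      MulAut.apply_inv_self]
    simpa [mul_comm k 2] using this
  · intro x hx hne
    have hx : (x : SurfaceExtension ε r).right = 1 := hx
    have hl : (x : SurfaceExtension ε r).left ≠ 1 := fun h =>
      hne (Subtype.ext (SemidirectProduct.ext h hx))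
    rcases total _ hl with h | h
    · exact Or.inl ⟨hx, h⟩
    · refine Or.inr ⟨by simp [hx], ?_⟩
      simpa [hx] using h

end SurfaceExtension

end

/-! ### Primitive recursion on words and the word problem of the extension -/

theorem Primrec.of_finite_left {ι σ τ : Type*} [Primcodable ι] [Finite ι] [Primcodable σ]
    [Primcodable τ] {f : ι → σ → τ} (hf : ∀ i, Primrec (f i)) : Primrec₂ f := by
  obtain ⟨m, ⟨e⟩⟩ := Finite.exists_equiv_fin ι
  -- All of the finitely many functions are evaluated, and the required entry is looked up
  -- afterwards.
  have h1 : Primrec fun x : ι × σ => List.ofFn fun j : Fin m => f (e.symm j) x.2 :=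
    Primrec.list_ofFn fun j => (hf (e.symm j)).comp Primrec.snd
  have h2 : Primrec fun x : ι × σ => (e x.1 : ℕ) :=
    (Primrec.dom_finite fun i => (e i : ℕ)).comp Primrec.fst
  refine Primrec.option_some_iff.1 ((Primrec.list_getElem?.comp h1 h2).of_eq fun x => ?_)
  simp

/-- The integers are coded as the sum of two copies of the natural numbers. -/
instance Int.primcodable : Primcodable ℤ :=
  Primcodable.ofEquiv (ℕ ⊕ ℕ) Equiv.intEquivNatSumNat

theorem Primrec.int_add_const (k : ℤ) : Primrec fun i : ℤ => i + k := by
  have hs : Primrec fun i : ℤ => i + 1 := by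
    have : Primrec fun i : ℤ => Equiv.intEquivNatSumNat.symm
        (Sum.casesOn (Equiv.intEquivNatSumNat i) (fun n => Sum.inl (n + 1))
          fun n => Nat.casesOn n (Sum.inl 0) fun m => Sum.inr m) :=
      Primrec.of_equiv_symm.comp (Primrec.sumCasesOn Primrec.of_equiv
        (Primrec.sumInl.comp (Primrec.succ.comp Primrec.snd)).to₂
        (Primrec.nat_casesOn Primrec.snd (Primrec.const (Sum.inl 0))
          (Primrec.sumInr.comp Primrec.snd).to₂).to₂)
    refine this.of_eq fun i => ?_
    rcases i with n | _ | n <;> rfl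
  have hp : Primrec fun i : ℤ => i - 1 := by
    have : Primrec fun i : ℤ => Equiv.intEquivNatSumNat.symm
        (Sum.casesOn (Equiv.intEquivNatSumNat i)
          (fun n => Nat.casesOn n (Sum.inr 0) fun m => Sum.inl m) fun n => Sum.inr (n + 1)) :=
      Primrec.of_equiv_symm.comp (Primrec.sumCasesOn Primrec.of_equiv
        (Primrec.nat_casesOn Primrec.snd (Primrec.const (Sum.inr 0))
          (Primrec.sumInl.comp Primrec.snd).to₂).to₂
        (Primrec.sumInr.comp (Primrec.succ.comp Primrec.snd)).to₂)
    refine this.of_eq fun i => ?_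
    rcases i with (_ | n) | n
    · rfl
    · change (n : ℤ) = ((n + 1 : ℕ) : ℤ) - 1
      push_cast
      ring
    · rfl
  induction k using Int.induction_on with
  | zero => exact Primrec.id.of_eq fun i => (add_zero i).symm
  | succ k ih => exact (hs.comp ih).of_eq fun i => by ring
  | pred k ih => exact (hp.comp ih).of_eq fun i => by ring

namespace FreeGroup

variable {β : Type*}

theorem primrec_reduce [Primcodable β] [DecidableEq β] :
    Primrec (FreeGroup.reduce : List (β × Bool) → List (β × Bool)) := by
  have hc : PrimrecPred fun x : ((List (β × Bool) × (β × Bool) × List (β × Bool)) ×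
      (β × Bool) × List (β × Bool)) =>
      x.1.2.1.1 = x.2.1.1 ∧ x.1.2.1.2 = not x.2.1.2 :=
    (Primrec.eq.comp
      (Primrec.fst.comp (Primrec.fst.comp (Primrec.snd.comp Primrec.fst)))
      (Primrec.fst.comp (Primrec.fst.comp Primrec.snd))).and
    (Primrec.eq.comp
      (Primrec.snd.comp (Primrec.fst.comp (Primrec.snd.comp Primrec.fst)))
      (Primrec.not.comp (Primrec.snd.comp (Primrec.fst.comp Primrec.snd))))
  have hstep : Primrec fun x : List (β × Bool) × (β × Bool) × List (β × Bool) =>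
      (List.casesOn x.2.2 [x.2.1] fun hd tl =>
        if x.2.1.1 = hd.1 ∧ x.2.1.2 = not hd.2 then tl else x.2.1 :: hd :: tl :
        List (β × Bool)) :=
    Primrec.list_casesOn (Primrec.snd.comp Primrec.snd)
      (Primrec.list_cons.comp (Primrec.fst.comp Primrec.snd) (Primrec.const []))
      (Primrec.ite hc (Primrec.snd.comp Primrec.snd)
        (Primrec.list_cons.comp (Primrec.fst.comp (Primrec.snd.comp Primrec.fst))
          (Primrec.list_cons.comp (Primrec.fst.comp Primrec.snd)
            (Primrec.snd.comp Primrec.snd)))).to₂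
  refine (Primrec.list_foldr Primrec.id (Primrec.const []) hstep.to₂).of_eq fun L => ?_
  induction L with
  | nil => rfl
  | cons a L ih =>
    rw [FreeGroup.reduce.cons, ← ih]
    rfl

/-- The substitution of words for letters. -/
def substWord (f : β → List (β × Bool)) (W : List (β × Bool)) : List (β × Bool) :=
  W.flatMap fun a => if a.2 then f a.1 else FreeGroup.invRev (f a.1)

theorem mk_substWord (f : β → List (β × Bool)) (W : List (β × Bool)) :
    FreeGroup.mk (substWord f W) =
      FreeGroup.lift (fun x => FreeGroup.mk (f x)) (FreeGroup.mk W) := by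
  induction W with
  | nil => simp [substWord, ← FreeGroup.one_eq_mk]
  | cons a W ih =>
    have h1 : substWord f (a :: W) =
        (if a.2 then f a.1 else FreeGroup.invRev (f a.1)) ++ substWord f W := rfl
    have h2 : a :: W = [a] ++ W := rfl
    rw [h1, h2, ← FreeGroup.mul_mk, ← FreeGroup.mul_mk, _root_.map_mul, ih]
    congr 1
    rcases a with ⟨x, _ | _⟩ <;> simp [FreeGroup.lift_mk]

theorem primrec_invRev [Primcodable β] :
    Primrec (FreeGroup.invRev : List (β × Bool) → List (β × Bool)) :=
  Primrec.list_reverse.comp (Primrec.list_map Primrec.id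
    (Primrec.pair (Primrec.fst.comp Primrec.snd)
      (Primrec.not.comp (Primrec.snd.comp Primrec.snd))).to₂)

theorem primrec_substWord [Primcodable β] {f : β → List (β × Bool)} (hf : Primrec f) :
    Primrec (substWord f) := by
  have h : Primrec fun x : List (β × Bool) × β × Bool => f x.2.1 :=
    hf.comp (Primrec.fst.comp Primrec.snd)
  have hc : PrimrecPred fun x : List (β × Bool) × β × Bool => x.2.2 = true :=
    Primrec.eq.comp (Primrec.snd.comp Primrec.snd) (Primrec.const true)
  exact Primrec.list_flatMap Primrec.id (Primrec.ite hc h (primrec_invRev.comp h)).to₂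

end FreeGroup

theorem wordEval_nil {G : Type*} [Group G] {n : ℕ} (s : Fin n → G) : wordEval s [] = 1 := rfl

theorem wordEval_cons {G : Type*} [Group G] {n : ℕ} (s : Fin n → G) (l : Fin n × Bool)
    (w : List (Fin n × Bool)) :
    wordEval s (l :: w) = (if l.2 then s l.1 else (s l.1)⁻¹) * wordEval s w := by
  simp [wordEval]

theorem wordEval_append {G : Type*} [Group G] {n : ℕ} (s : Fin n → G)
    (v w : List (Fin n × Bool)) : wordEval s (v ++ w) = wordEval s v * wordEval s w := by
  simp [wordEval]

theorem map_wordEval {G H : Type*} [Group G] [Group H] (f : G →* H) {n : ℕ} (s : Fin n → G)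
    (w : List (Fin n × Bool)) : f (wordEval s w) = wordEval (f ∘ s) w := by
  induction w with
  | nil => simp [wordEval_nil]
  | cons l w ih =>
    rw [wordEval_cons, wordEval_cons, map_mul, ih]
    split_ifs <;> simp

namespace SurfaceExtension

variable {Y : Type*}

theorem shift_zpow_of_some (ε : ℤˣ) (r : FreeGroup Y) (k : ℤ) (y : Y) (i : ℤ) :
    (shift ε r ^ k) (FreeGroup.of (some (y, i))) = FreeGroup.of (some (y, i + k)) := by
  induction k using Int.induction_on with
  | zero => simp
  | succ k ih =>
    rw [add_comm, zpow_add, zpow_one, MulAut.mul_apply, ih, shift_of_some, add_assoc]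
    simp [add_comm]
  | pred k ih =>
    rw [sub_eq_neg_add, zpow_add, zpow_neg_one, MulAut.mul_apply, ih, MulAut.inv_apply,
      MulEquiv.symm_apply_eq, shift_of_some]
    congr 3
    ring

open Classical in
/-- The left multiplication by an element, on pairs of a word and an integer. -/
noncomputable def actWord {ε : ℤˣ} {r : FreeGroup Y} (e : SurfaceExtension ε r)
    (x : List (Option (Y × ℤ) × Bool) × ℤ) : List (Option (Y × ℤ) × Bool) × ℤ :=
  (e.left.toWord ++ FreeGroup.substWord (fun a =>
    ((shift ε r ^ Multiplicative.toAdd e.right) (FreeGroup.of a)).toWord) x.1,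
    x.2 + Multiplicative.toAdd e.right)

/-- As `e` is fixed, so is the power of the shift: it translates levels by a constant and sends
`none` to one fixed word. -/
theorem primrec_actWord [Primcodable Y] {ε : ℤˣ} {r : FreeGroup Y}
    (e : SurfaceExtension ε r) : Primrec (actWord e) := by
  classical
  have h : Primrec fun a : Option (Y × ℤ) =>
      ((shift ε r ^ Multiplicative.toAdd e.right) (FreeGroup.of a)).toWord := by
    have : Primrec fun a : Option (Y × ℤ) => (Option.casesOn a
        ((shift ε r ^ Multiplicative.toAdd e.right) (FreeGroup.of none)).toWord
        fun x => [(some (x.1, x.2 + Multiplicative.toAdd e.right), true)] :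
        List (Option (Y × ℤ) × Bool)) :=
      Primrec.option_casesOn Primrec.id (Primrec.const _)
        (Primrec.list_cons.comp (Primrec.pair (Primrec.option_some.comp
          (Primrec.pair (Primrec.fst.comp Primrec.snd)
            ((Primrec.int_add_const _).comp (Primrec.snd.comp Primrec.snd))))
          (Primrec.const true)) (Primrec.const [])).to₂
    refine this.of_eq fun a => ?_
    rcases a with _ | ⟨y, i⟩
    · rfl
    · simp only [shift_zpow_of_some, FreeGroup.toWord_of]
  unfold actWord
  convert Primrec.pair (Primrec.list_append.comp (Primrec.const e.left.toWord)
    ((FreeGroup.primrec_substWord h).comp Primrec.fst))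
    ((Primrec.int_add_const _).comp Primrec.snd)

theorem mk_actWord {ε : ℤˣ} {r : FreeGroup Y} (e x : SurfaceExtension ε r)
    (st : List (Option (Y × ℤ) × Bool) × ℤ) (h1 : FreeGroup.mk st.1 = x.left)
    (h2 : st.2 = Multiplicative.toAdd x.right) :
    FreeGroup.mk (actWord e st).1 = (e * x).left ∧
      (actWord e st).2 = Multiplicative.toAdd (e * x).right := by
  classical
  constructor
  · rw [actWord, ← FreeGroup.mul_mk, FreeGroup.mk_toWord, FreeGroup.mk_substWord, h1,
      SemidirectProduct.mul_left]
    congr 1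
    have : FreeGroup.lift (fun a =>
        FreeGroup.mk ((shift ε r ^ Multiplicative.toAdd e.right) (FreeGroup.of a)).toWord) =
        (shift ε r ^ Multiplicative.toAdd e.right : MulAut _).toMonoidHom := by
      ext1 a
      simp [FreeGroup.mk_toWord]
    rw [this]
    rfl
  · rw [actWord, h2, SemidirectProduct.mul_right, toAdd_mul, add_comm]

/-- Reading the word from its end, left multiplications build a free word and an exponent; the
element is trivial when the word reduces to nothing and the exponent is zero. -/
theorem computablePred_wordEval_eq_one [Primcodable Y] {ε : ℤˣ} {r : FreeGroup Y} {n : ℕ}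
    (s : Fin n → SurfaceExtension ε r) : ComputablePred fun w => wordEval s w = 1 := by
  classical
  let run : List (Fin n × Bool) → List (Option (Y × ℤ) × Bool) × ℤ :=
    List.foldr (fun l => actWord (if l.2 then s l.1 else (s l.1)⁻¹)) ([], 0)
  have hrun : Primrec run :=
    Primrec.list_foldr Primrec.id (Primrec.const _)
      ((Primrec.of_finite_left (f := fun l : Fin n × Bool =>
        actWord (if l.2 then s l.1 else (s l.1)⁻¹)) fun _ => primrec_actWord _).comp
        (Primrec.fst.comp Primrec.snd) (Primrec.snd.comp Primrec.snd)).to₂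
  have hspec : ∀ w, FreeGroup.mk (run w).1 = (wordEval s w).left ∧
      (run w).2 = Multiplicative.toAdd (wordEval s w).right := by
    intro w
    induction w with
    | nil => exact ⟨rfl, rfl⟩
    | cons l w ih =>
      rw [wordEval_cons]
      exact mk_actWord _ _ _ ih.1 ih.2
  have hp : PrimrecPred fun w => FreeGroup.reduce (run w).1 = [] ∧ (run w).2 = 0 :=
    (Primrec.eq.comp (FreeGroup.primrec_reduce.comp (Primrec.fst.comp hrun))
      (Primrec.const [])).and
    (Primrec.eq.comp (Primrec.snd.comp hrun) (Primrec.const 0))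
  refine hp.computablePred.of_eq fun w => ?_
  rw [SemidirectProduct.ext_iff, SemidirectProduct.one_left, SemidirectProduct.one_right,
    ← (hspec w).1, (hspec w).2]
  refine and_congr ⟨fun h => ?_, fun h => ?_⟩ Iff.rfl
  · rw [← FreeGroup.reduce.self, h, ← FreeGroup.one_eq_mk]
  · rw [← FreeGroup.toWord_mk, h, FreeGroup.toWord_one]

theorem hasSolvableWordProblem_of_injective [Primcodable Y] {ε : ℤˣ} {r : FreeGroup Y}
    {G : Type*} [Group G] [Group.FG G] (f : G →* SurfaceExtension ε r)
    (hf : Function.Injective f) : HasSolvableWordProblem G := by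
  obtain ⟨S, hS, hfin⟩ := Group.fg_iff.1 ‹Group.FG G›
  obtain ⟨n, s, -, rfl⟩ := hfin.fin_param
  refine ⟨n, s, hS, (computablePred_wordEval_eq_one (f ∘ s)).of_eq fun w => ?_⟩
  rw [← map_wordEval, map_eq_one_iff f hf]

end SurfaceExtension

theorem HasSolvableWordProblem.of_finite (G : Type*) [Group G] [Finite G] :
    HasSolvableWordProblem G := by
  obtain ⟨n, ⟨e⟩⟩ := Finite.exists_equiv_fin G
  refine ⟨n, e.symm, by simp, ?_⟩
  let run : List (Fin n × Bool) → Fin n :=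
    List.foldr (fun l x => e ((if l.2 then e.symm l.1 else (e.symm l.1)⁻¹) * e.symm x)) (e 1)
  have hrun : Primrec run :=
    Primrec.list_foldr Primrec.id (Primrec.const _)
      ((Primrec.dom_finite fun x : (Fin n × Bool) × Fin n =>
        e ((if x.1.2 then e.symm x.1.1 else (e.symm x.1.1)⁻¹) * e.symm x.2)).comp
        Primrec.snd).to₂
  have hspec : ∀ w, run w = e (wordEval e.symm w) := by
    intro w
    induction w with
    | nil => rfl
    | cons l w ih =>
      rw [wordEval_cons]
      change e (_ * e.symm (run w)) = _
      rw [ih, e.symm_apply_apply]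
  have hp : PrimrecPred fun w => run w = e 1 := Primrec.eq.comp hrun (Primrec.const _)
  refine hp.computablePred.of_eq fun w => ?_
  rw [hspec, e.apply_eq_iff_eq]

/-! ### Testing containment of a finite-index subgroup on short words -/

theorem wordEval_eq_lift {G : Type*} [Group G] {n : ℕ} (s : Fin n → G)
    (w : List (Fin n × Bool)) : wordEval s w = FreeGroup.lift s (FreeGroup.mk w) := by
  rw [FreeGroup.lift_mk, wordEval]
  congr 2
  ext ⟨x, _ | _⟩ <;> rfl

theorem wordEval_invRev {G : Type*} [Group G] {n : ℕ} (s : Fin n → G)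
    (w : List (Fin n × Bool)) : wordEval s (FreeGroup.invRev w) = (wordEval s w)⁻¹ := by
  rw [wordEval_eq_lift, wordEval_eq_lift, ← FreeGroup.inv_mk, map_inv]

theorem wordEval_surjective {G : Type*} [Group G] {n : ℕ} {s : Fin n → G}
    (hs : Subgroup.closure (Set.range s) = ⊤) : Function.Surjective (wordEval s) := by
  intro g
  have : g ∈ (FreeGroup.lift s).range := by
    rw [FreeGroup.range_lift_eq_closure, hs]
    trivial
  obtain ⟨x, rfl⟩ := this
  obtain ⟨w, rfl⟩ := Quot.exists_rep x
  exact ⟨w, wordEval_eq_lift s w⟩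

/-- To contain a subgroup of index at most `N`, it suffices to contain its elements
represented by words of length at most `2 * N`. -/
theorem wordEval_mem_of_short {G : Type*} [Group G] {n : ℕ} (s : Fin n → G)
    {D K : Subgroup G} [D.FiniteIndex] {N : ℕ} (hN : D.index ≤ N)
    (h : ∀ u : List (Fin n × Bool), u.length ≤ 2 * N → wordEval s u ∈ D → wordEval s u ∈ K)
    (u : List (Fin n × Bool)) (hu : wordEval s u ∈ D) : wordEval s u ∈ K := by
  induction hlen : u.length using Nat.strong_induction_on generalizing u with
  | _ m ih =>
  subst hlen
  by_cases hshort : u.length ≤ 2 * N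
  · exact h u hshort hu
  rw [not_le] at hshort
  have : Finite (G ⧸ D) := Subgroup.finite_quotient_of_finiteIndex
  have := Fintype.ofFinite (G ⧸ D)
  -- The suffixes of lengths `0, …, N` are one more than the cosets can be, so two of them share a
  -- coset.
  obtain ⟨i, j, hij, e⟩ : ∃ i j : Fin (N + 1), i < j ∧
      (QuotientGroup.mk (wordEval s (u.drop (u.length - i))) : G ⧸ D) =
        QuotientGroup.mk (wordEval s (u.drop (u.length - j))) := by
    obtain ⟨i, j, hij, e⟩ := Fintype.exists_ne_map_eq_of_card_lt
      (fun i : Fin (N + 1) =>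
        (QuotientGroup.mk (wordEval s (u.drop (u.length - i))) : G ⧸ D))
      (by rw [Fintype.card_fin, ← Nat.card_eq_fintype_card]; exact Nat.lt_succ_of_le hN)
    rcases lt_or_gt_of_ne hij with h | h
    · exact ⟨i, j, h, e⟩
    · exact ⟨j, i, h, e.symm⟩
  have hij : (i : ℕ) < j := hij
  have hj : (j : ℕ) ≤ N := Nat.lt_succ_iff.1 j.2
  set x := u.take (u.length - j)
  set v := u.drop (u.length - i)
  set w := u.drop (u.length - j)
  have hxw : wordEval s u = wordEval s x * wordEval s w := by
    rw [← wordEval_append, List.take_append_drop]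
  have hx : x.length = u.length - j := by simp [x]
  have hv : v.length = i := by simp only [v, List.length_drop]; omega
  have hw : w.length = j := by simp only [w, List.length_drop]; omega
  have e2 : wordEval s (FreeGroup.invRev v ++ w) = (wordEval s v)⁻¹ * wordEval s w := by
    rw [wordEval_append, wordEval_invRev]
  have h2 : wordEval s (FreeGroup.invRev v ++ w) ∈ D := by
    rw [e2]
    exact QuotientGroup.eq.1 e
  -- Replacing the suffix `w` by the shorter `v` stays in `D` and allows induction; the correction
  -- `v⁻¹ w` has length `i + j ≤ 2 * N`.
  have e1 : wordEval s u = wordEval s (x ++ v) * wordEval s (FreeGroup.invRev v ++ w) := by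
    rw [e2, hxw, wordEval_append]
    group
  have h1 : wordEval s (x ++ v) ∈ D := by
    rw [e1] at hu
    exact (Subgroup.mul_mem_cancel_right D h2).1 hu
  rw [e1]
  refine mul_mem (ih _ ?_ _ h1 rfl) (h _ ?_ h2)
  · rw [List.length_append, hx, hv]
    omega
  · rw [List.length_append, FreeGroup.invRev_length, hv, hw]
    omega

/-! ### Virtual isomorphisms as partial functions on words -/

namespace VirtualIso

variable {G : Type*} [Group G]

/-- The identity of a subgroup of finite index. -/
def idOn (K : Subgroup G) (hK : K.FiniteIndex) : VirtualIso G where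
  dom := K
  cod := K
  finiteIndex_dom := hK
  finiteIndex_cod := hK
  equiv := MulEquiv.refl _

theorem mk_idOn (K : Subgroup G) (hK : K.FiniteIndex) : Comm.mk (idOn K hK) = 1 :=
  Quotient.sound ⟨K, hK, fun _ h => ⟨h, Subgroup.mem_top _, rfl⟩⟩

/-- A virtual isomorphism with domain and image inside `K`. -/
def Inside (K : Subgroup G) (φ : VirtualIso G) : Prop :=
  ∀ (x : G) (h : x ∈ φ.dom), x ∈ K ∧ φ.toHom ⟨x, h⟩ ∈ K

theorem inside_idOn (K : Subgroup G) (hK : K.FiniteIndex) : Inside K (idOn K hK) :=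
  fun _ h => ⟨h, h⟩

theorem Inside.comp {K : Subgroup G} {φ ψ : VirtualIso G} (hφ : Inside K φ)
    (hψ : Inside K ψ) : Inside K (φ.comp ψ) := by
  intro x h
  obtain ⟨h1, h2⟩ := mem_pre.1 h
  exact ⟨(hψ x h1).1, (hφ _ h2).2⟩

/-- Composing on both sides with the identity of `K` restricts domain and image without changing the
class. -/
theorem exists_inside (K : Subgroup G) (hK : K.FiniteIndex) (c : Comm G) :
    ∃ φ, Comm.mk φ = c ∧ Inside K φ := by
  obtain ⟨φ, rfl⟩ := Quotient.exists_rep c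
  refine ⟨(idOn K hK).comp (φ.comp (idOn K hK)), ?_, ?_⟩
  · rw [← Comm.mk_mul_mk, ← Comm.mk_mul_mk, mk_idOn, one_mul, mul_one]
    rfl
  · intro x h
    obtain ⟨h1, h2⟩ := mem_pre.1 h
    exact ⟨(mem_pre.1 h1).1, h2⟩

theorem index_comp_le (φ ψ : VirtualIso G) :
    (φ.comp ψ).dom.index ≤ φ.dom.index * ψ.dom.index := by
  have := φ.finiteIndex_dom
  change (ψ.pre φ.dom).index ≤ _
  rw [pre, Subgroup.index_map_subtype, Subgroup.index_comap]
  refine Nat.mul_le_mul_right _ ?_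
  rw [← Subgroup.relIndex_top_right]
  exact Subgroup.relIndex_le_of_le_right le_top (by simpa using this.index_ne_zero)

/-- A positive power of `x` lies in the subgroup where `φ` is the identity, so `φ x` and `x` have a
common power. Both lie in `K`, hence they agree: equivalence to the identity becomes equality on the
whole domain. -/
theorem toHom_eq_of_mk_eq_one {K : Subgroup G} (hK : UniqueRootProperty K) {φ : VirtualIso G}
    (hφ : Inside K φ) (h : Comm.mk φ = 1) (x : G) (hx : x ∈ φ.dom) : φ.toHom ⟨x, hx⟩ = x := by
  rw [Comm.one_def, Comm.mk_eq_mk] at h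
  obtain ⟨L, hL, h⟩ := h
  obtain ⟨m, hm, -, hmem⟩ := Subgroup.exists_pow_mem_of_index_ne_zero hL.index_ne_zero x
  obtain ⟨h1, _, e⟩ := h _ hmem
  have e : φ.toHom ⟨x ^ m, h1⟩ = x ^ m := e
  have e' : φ.toHom ⟨x, hx⟩ ^ m = x ^ m := by
    rw [← map_pow]
    exact e
  have := hK ⟨_, (hφ x hx).2⟩ ⟨x, (hφ x hx).1⟩ m (by exact_mod_cast hm.ne')
    (Subtype.ext (by simpa using e'))
  exact congrArg Subtype.val this

theorem mk_eq_one_of_toHom_eq {φ : VirtualIso G}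
    (h : ∀ (x : G) (hx : x ∈ φ.dom), φ.toHom ⟨x, hx⟩ = x) : Comm.mk φ = 1 := by
  rw [Comm.one_def, Comm.mk_eq_mk]
  exact ⟨φ.dom, φ.finiteIndex_dom, fun x hx => ⟨hx, Subgroup.mem_top _, h x hx⟩⟩

/-- The partial function `T` on words represents `φ`. -/
def Represents {n : ℕ} (s : Fin n → G)
    (T : List (Fin n × Bool) → Option (List (Fin n × Bool))) (φ : VirtualIso G) : Prop :=
  ∀ u, (T u = none → wordEval s u ∉ φ.dom) ∧ ∀ u', T u = some u' →
    ∃ h : wordEval s u ∈ φ.dom, wordEval s u' = φ.toHom ⟨wordEval s u, h⟩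

theorem Represents.comp {n : ℕ} {s : Fin n → G}
    {T T' : List (Fin n × Bool) → Option (List (Fin n × Bool))} {φ ψ : VirtualIso G}
    (h : Represents s T φ) (h' : Represents s T' ψ) :
    Represents s (fun u => (T' u).bind T) (φ.comp ψ) := by
  intro u
  constructor
  · intro hu hmem
    obtain ⟨h1, h2⟩ := mem_pre.1 hmem
    cases hT : T' u with
    | none => exact (h' u).1 hT h1
    | some v =>
      obtain ⟨_, e⟩ := (h' u).2 v hT
      have hu : (T' u).bind T = none := hu
      rw [hT, Option.bind_some] at hu
      rw [← e] at h2
      exact (h v).1 hu h2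
  · intro u' hu
    obtain ⟨v, hv, hu⟩ := Option.bind_eq_some_iff.1 hu
    obtain ⟨h1, e⟩ := (h' u).2 v hv
    obtain ⟨h2, e'⟩ := (h v).2 u' hu
    refine ⟨mem_pre.2 ⟨h1, e ▸ h2⟩, e'.trans ?_⟩
    exact congrArg φ.toHom (Subtype.ext e)

open Classical in
/-- A representative of a left coset; the coset of `1` is represented by `1`. -/
noncomputable def cosetRep (D : Subgroup G) (q : G ⧸ D) : G :=
  if q = QuotientGroup.mk 1 then 1 else q.out

theorem mk_cosetRep (D : Subgroup G) (q : G ⧸ D) : QuotientGroup.mk (cosetRep D q) = q := by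
  rw [cosetRep]
  split_ifs with h
  · exact h.symm
  · exact QuotientGroup.out_eq' q

theorem cosetRep_inv_mul_mem (D : Subgroup G) (g : G) :
    (cosetRep D (QuotientGroup.mk g))⁻¹ * g ∈ D :=
  QuotientGroup.eq.1 (mk_cosetRep D _)

/-- A virtual isomorphism is represented by a finite-state transducer. -/
theorem exists_represents {n : ℕ} {s : Fin n → G}
    (hs : Subgroup.closure (Set.range s) = ⊤) (φ : VirtualIso G) :
    ∃ T, Primrec T ∧ Represents s T φ := by
  classical
  have := φ.finiteIndex_dom
  have : Finite (G ⧸ φ.dom) := Subgroup.finite_quotient_of_finiteIndex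
  obtain ⟨d, ⟨e⟩⟩ := Finite.exists_equiv_fin (G ⧸ φ.dom)
  choose wd hwd using wordEval_surjective hs
  let val : Fin n × Bool → G := fun l => if l.2 then s l.1 else (s l.1)⁻¹
  let rep : Fin d → G := fun q => cosetRep φ.dom (e.symm q)
  -- The input is read from its end, and the state is the coset of the suffix read so far.
  let next : (Fin n × Bool) × Fin d → Fin d := fun x =>
    e (QuotientGroup.mk (val x.1 * rep x.2))
  have hmem : ∀ x, (rep (next x))⁻¹ * (val x.1 * rep x.2) ∈ φ.dom := by
    intro x
    simp only [rep, next, Equiv.symm_apply_apply]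
    exact cosetRep_inv_mul_mem _ _
  -- The output is a word for the image of the Schreier element of the transition. The accumulated
  -- output represents the image of `rep⁻¹ * u`, where `rep` represents the current coset.
  let out : (Fin n × Bool) × Fin d → List (Fin n × Bool) := fun x =>
    wd (φ.toHom ⟨_, hmem x⟩)
  let run : List (Fin n × Bool) → Fin d × List (Fin n × Bool) :=
    List.foldr (fun l x => (next (l, x.1), out (l, x.1) ++ x.2)) (e (QuotientGroup.mk 1), [])
  have hrun : Primrec run := by
    have h1 : Primrec fun x : List (Fin n × Bool) × (Fin n × Bool) ×
        Fin d × List (Fin n × Bool) => (x.2.1, x.2.2.1) :=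
      Primrec.pair (Primrec.fst.comp Primrec.snd)
        (Primrec.fst.comp (Primrec.snd.comp Primrec.snd))
    exact Primrec.list_foldr Primrec.id (Primrec.const _)
      (Primrec.pair ((Primrec.dom_finite next).comp h1)
        (Primrec.list_append.comp ((Primrec.dom_finite out).comp h1)
          (Primrec.snd.comp (Primrec.snd.comp Primrec.snd)))).to₂
  have hspec : ∀ u, (run u).1 = e (QuotientGroup.mk (wordEval s u)) ∧
      ∃ h : (rep (run u).1)⁻¹ * wordEval s u ∈ φ.dom,
        wordEval s (run u).2 = φ.toHom ⟨_, h⟩ := by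
    intro u
    induction u with
    | nil =>
      refine ⟨rfl, ?_⟩
      have h1 : (rep (run []).1)⁻¹ * wordEval s [] = 1 := by
        simp [run, rep, cosetRep, wordEval_nil]
      refine ⟨h1 ▸ one_mem _, ?_⟩
      simp only [h1]
      exact (map_one φ.toHom).symm
    | cons l u ih =>
      obtain ⟨ih1, h2, ih2⟩ := ih
      have hfst : (run (l :: u)).1 = next (l, (run u).1) := rfl
      have hsnd : (run (l :: u)).2 = out (l, (run u).1) ++ (run u).2 := rfl
      have hcons : wordEval s (l :: u) = val l * wordEval s u := wordEval_cons s l u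
      have hprod : (rep (run (l :: u)).1)⁻¹ * wordEval s (l :: u) =
          ((rep (next (l, (run u).1)))⁻¹ * (val l * rep (run u).1)) *
            ((rep (run u).1)⁻¹ * wordEval s u) := by
        rw [hfst, hcons]
        group
      refine ⟨?_, ?_⟩
      · rw [hfst, hcons]
        refine congrArg e (QuotientGroup.eq.2 ?_)
        rw [mul_inv_rev, mul_assoc, inv_mul_cancel_left]
        exact h2
      · have hm := mul_mem (hmem (l, (run u).1)) h2
        refine ⟨hprod ▸ hm, ?_⟩
        rw [hsnd, wordEval_append, ih2]
        simp only [hprod]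
        change wordEval s (wd (φ.toHom ⟨_, hmem (l, (run u).1)⟩)) * _ = _
        rw [hwd, ← map_mul]
        rfl
  -- The trivial coset is the accepting state; its representative is `1`, so the output there
  -- represents the image of `u` itself.
  refine ⟨fun u => if (run u).1 = e (QuotientGroup.mk 1) then some (run u).2 else none,
    Primrec.ite (Primrec.eq.comp (Primrec.fst.comp hrun) (Primrec.const _))
      (Primrec.option_some.comp (Primrec.snd.comp hrun)) (Primrec.const _), fun u => ?_⟩
  have hiff : (run u).1 = e (QuotientGroup.mk 1) ↔ wordEval s u ∈ φ.dom := by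
    rw [(hspec u).1, e.apply_eq_iff_eq, eq_comm, QuotientGroup.eq, inv_one, one_mul]
  refine ⟨fun h => ?_, fun u' h => ?_⟩
  · rw [← hiff]
    intro h'
    dsimp only at h
    rw [if_pos h'] at h
    simp at h
  · dsimp only at h
    by_cases h' : (run u).1 = e (QuotientGroup.mk 1)
    · rw [if_pos h', Option.some_inj] at h
      obtain ⟨-, h3, h4⟩ := hspec u
      refine ⟨hiff.1 h', ?_⟩
      have hrep : (rep (run u).1)⁻¹ * wordEval s u = wordEval s u := by
        simp [h', rep, cosetRep]
      rw [← h, h4]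
      simp only [hrep]
    · rw [if_neg h'] at h
      simp at h

end VirtualIso

/-! ### The decision procedure for the commensurator -/

theorem ComputablePred.forall_mem_list {α : Type*} [Primcodable α] {p : α → Prop}
    (hp : ComputablePred p) : ComputablePred fun L : List α => ∀ a ∈ L, p a := by
  obtain ⟨f, hf, rfl⟩ := ComputablePred.computable_iff.1 hp
  rw [ComputablePred.computable_iff]
  -- Entries are tested by recursion on the position; the value `true` beyond the end of the list is
  -- neutral for the conjunction.
  have hstep : Computable fun x : List α × ℕ × Bool =>
      (x.2.2 && (Option.casesOn x.1[x.2.1]? true f : Bool)) :=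
    (Primrec.and.to_comp).comp (Computable.snd.comp Computable.snd)
      (Computable.option_casesOn
        (Computable.list_getElem?.comp Computable.fst (Computable.fst.comp Computable.snd))
        (Computable.const true) (hf.comp Computable.snd).to₂)
  refine ⟨_, Computable.nat_rec Computable.list_length (Computable.const true) hstep.to₂, ?_⟩
  funext L
  have key : ∀ m : ℕ, (Nat.rec true
      (fun k b => b && (Option.casesOn L[k]? true f : Bool)) m : Bool) = true ↔
      ∀ k < m, ∀ a, L[k]? = some a → f a = true := by
    intro m
    induction m with
    | zero => simp
    | succ m ih =>
      have : (Option.casesOn L[m]? true f : Bool) = true ↔ ∀ a, L[m]? = some a → f a = true := by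
        cases L[m]? <;> simp
      simp only [Bool.and_eq_true, ih, this, Nat.lt_succ_iff_lt_or_eq]
      constructor
      · rintro ⟨h1, h2⟩ k (hk | rfl)
        · exact h1 k hk
        · exact h2
      · exact fun h => ⟨fun k hk => h k (Or.inl hk), h m (Or.inr rfl)⟩
  refine propext (Iff.trans ?_ (key L.length).symm)
  constructor
  · exact fun h k _ a e => h a (List.mem_of_getElem? e)
  · intro h a ha
    obtain ⟨k, hk, rfl⟩ := List.getElem_of_mem ha
    exact h k hk _ (List.getElem?_eq_getElem hk)

theorem ComputablePred.comp_computable {α β : Type*} [Primcodable α] [Primcodable β]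
    {p : β → Prop} (hp : ComputablePred p) {g : α → β} (hg : Computable g) :
    ComputablePred fun a => p (g a) := by
  obtain ⟨f, hf, rfl⟩ := ComputablePred.computable_iff.1 hp
  exact ComputablePred.computable_iff.2 ⟨_, hf.comp hg, rfl⟩

/-- The words of length at most `N`. -/
noncomputable def shortWords (α : Type*) [Fintype α] (N : ℕ) : List (List α) :=
  Nat.rec [[]] (fun _ L => [] :: L.flatMap fun u =>
    (Finset.univ : Finset α).toList.map fun a => a :: u) N

theorem mem_shortWords {α : Type*} [Fintype α] {N : ℕ} {u : List α} (h : u.length ≤ N) :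
    u ∈ shortWords α N := by
  induction N generalizing u with
  | zero =>
    rw [Nat.le_zero, List.length_eq_zero_iff] at h
    simp [h, shortWords]
  | succ N ih =>
    change u ∈ [] :: (shortWords α N).flatMap _
    cases u with
    | nil => simp
    | cons a u =>
      rw [List.mem_cons, List.mem_flatMap]
      exact Or.inr ⟨u, ih (by simpa using h), by simp⟩

theorem primrec_shortWords (α : Type*) [Fintype α] [Primcodable α] :
    Primrec (shortWords α) := by
  have h : Primrec₂ fun (_ : ℕ × List (List α)) (u : List α) =>
      (Finset.univ : Finset α).toList.map fun a => a :: u :=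
    (Primrec.list_map (Primrec.const _)
      (Primrec.list_cons.comp Primrec.snd (Primrec.snd.comp Primrec.fst)).to₂).to₂
  exact Primrec.nat_rec₁ _ (Primrec.list_cons.comp (Primrec.const [])
    (Primrec.list_flatMap Primrec.snd h)).to₂

open VirtualIso in
/-- If a group with solvable word problem has a subgroup of finite index with the unique
root property, then every finitely generated subgroup of its abstract commensurator has
solvable word problem. -/
theorem hasSolvableWordProblem_of_subgroup_comm {Γ : Type*} [Group Γ]
    (hΓ : HasSolvableWordProblem Γ) (hroot : VirtualUniqueRoots Γ) (H : Subgroup (Comm Γ))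
    (hH : H.FG) : HasSolvableWordProblem H := by
  obtain ⟨n, s, hs, hwp⟩ := hΓ
  obtain ⟨K, hK, hroot⟩ := hroot
  have : Group.FG H := (Group.fg_iff_subgroup_fg H).2 hH
  obtain ⟨S, hS, hfin⟩ := Group.fg_iff.1 this
  obtain ⟨m, t, -, rfl⟩ := hfin.fin_param
  refine ⟨m, t, hS, ?_⟩
  have hrep : ∀ l : Fin m × Bool, ∃ φ : VirtualIso Γ,
      Comm.mk φ = ((if l.2 then t l.1 else (t l.1)⁻¹ : H) : Comm Γ) ∧ Inside K φ :=
    fun l => exists_inside K hK _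
  choose φ hφ hin using hrep
  choose T hT hTφ using fun l => exists_represents hs (φ l)
  obtain ⟨T0, hT0, hTid⟩ := exists_represents hs (idOn K hK)
  let comps : List (Fin m × Bool) → VirtualIso Γ :=
    List.foldr (fun l Φ => (φ l).comp Φ) (idOn K hK)
  have hmk : ∀ w, Comm.mk (comps w) = ((wordEval t w : H) : Comm Γ) := by
    intro w
    induction w with
    | nil => exact mk_idOn K hK
    | cons l w ih =>
      change Comm.mk ((φ l).comp (comps w)) = _
      rw [← Comm.mk_mul_mk, ih, hφ, wordEval_cons, Subgroup.coe_mul]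
  have hinside : ∀ w, Inside K (comps w) := by
    intro w
    induction w with
    | nil => exact inside_idOn K hK
    | cons l w ih => exact (hin l).comp ih
  let run : List (Fin m × Bool) → List (Fin n × Bool) → Option (List (Fin n × Bool)) :=
    fun w u => List.foldr (fun l o => o.bind (T l)) (T0 u) w
  have hrunφ : ∀ w, Represents s (run w) (comps w) := by
    intro w
    induction w with
    | nil => exact hTid
    | cons l w ih => exact (hTφ l).comp ih
  have hrun : Primrec₂ run := by
    have h1 : Primrec₂ fun (x : (List (Fin m × Bool) × List (Fin n × Bool)) ×
        (Fin m × Bool) × Option (List (Fin n × Bool))) (u : List (Fin n × Bool)) => T x.2.1 u :=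
      (Primrec.of_finite_left hT).comp
        (Primrec.fst.comp (Primrec.snd.comp Primrec.fst)) Primrec.snd
    exact Primrec.list_foldr Primrec.fst (hT0.comp Primrec.snd) (Primrec.option_bind
      (Primrec.snd.comp Primrec.snd) h1).to₂
  -- The sum of all indices bounds each of them, so every letter multiplies the bound by the same
  -- constant.
  let bound : List (Fin m × Bool) → ℕ :=
    List.foldr (fun l N => (∑ l, (φ l).dom.index) * N) K.index
  have hbound : Primrec bound :=
    Primrec.list_foldr Primrec.id (Primrec.const _)
      (Primrec.nat_mul.comp (Primrec.const _) (Primrec.snd.comp Primrec.snd)).to₂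
  have hindex : ∀ w, (comps w).dom.index ≤ bound w := by
    intro w
    induction w with
    | nil => exact le_rfl
    | cons l w ih =>
      refine (index_comp_le (φ l) (comps w)).trans (Nat.mul_le_mul ?_ ih)
      exact Finset.single_le_sum (f := fun l => (φ l).dom.index) (fun _ _ => Nat.zero_le _)
        (Finset.mem_univ l)
  -- A test word `u⁻¹ u'` is trivial exactly when the composite fixes the element given by `u`;
  -- words outside the domain yield no test.
  let tests : List (Fin m × Bool) → List (List (Fin n × Bool)) := fun w =>
    (shortWords (Fin n × Bool) (2 * bound w)).flatMap fun u =>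
      Option.casesOn (run w u) [] fun u' => [FreeGroup.invRev u ++ u']
  have htests : Primrec tests := by
    refine Primrec.list_flatMap ((primrec_shortWords _).comp
      (Primrec.nat_mul.comp (Primrec.const 2) hbound)) ?_
    exact Primrec.option_casesOn (hrun.comp Primrec.fst Primrec.snd) (Primrec.const [])
      (Primrec.list_cons.comp (Primrec.list_append.comp
        (FreeGroup.primrec_invRev.comp (Primrec.snd.comp Primrec.fst)) Primrec.snd)
        (Primrec.const [])).to₂
  refine (hwp.forall_mem_list.comp_computable htests.to_comp).of_eq fun w => ?_
  have hone : wordEval t w = 1 ↔ Comm.mk (comps w) = 1 := by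
    rw [hmk, OneMemClass.coe_eq_one]
  rw [hone]
  constructor
  · intro h
    have := (comps w).finiteIndex_dom
    -- The fixed points of the composite form a subgroup, so the criterion for short words applies
    -- to it.
    let F : Subgroup Γ := ((comps w).toHom.eqLocus (comps w).dom.subtype).map
      (comps w).dom.subtype
    have hF : ∀ u, wordEval s u ∈ (comps w).dom → wordEval s u ∈ F := by
      refine wordEval_mem_of_short s (hindex w) fun u hu hmem => ?_
      cases hr : run w u with
      | none => exact absurd hmem ((hrunφ w u).1 hr)
      | some u' =>
        obtain ⟨h1, e⟩ := (hrunφ w u).2 u' hr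
        have h2 : FreeGroup.invRev u ++ u' ∈ tests w :=
          List.mem_flatMap.2 ⟨u, mem_shortWords hu, by rw [hr]; simp⟩
        have h3 := h _ h2
        rw [wordEval_append, wordEval_invRev, inv_mul_eq_one] at h3
        exact ⟨⟨_, h1⟩, e.symm.trans h3.symm, rfl⟩
    refine mk_eq_one_of_toHom_eq fun x hx => ?_
    obtain ⟨u, rfl⟩ := wordEval_surjective hs x
    obtain ⟨⟨y, hy⟩, e, rfl⟩ := hF u hx
    exact e
  -- Here unique roots enter: a composite with trivial class fixes every point of its domain, so
  -- each test succeeds.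
  · intro h v hv
    obtain ⟨u, hu, hv⟩ := List.mem_flatMap.1 hv
    cases hr : run w u with
    | none => simp [hr] at hv
    | some u' =>
      obtain ⟨h1, e⟩ := (hrunφ w u).2 u' hr
      have hv : v = FreeGroup.invRev u ++ u' := by simpa [hr] using hv
      rw [hv, wordEval_append, wordEval_invRev, inv_mul_eq_one, e]
      exact (toHom_eq_of_mk_eq_one hroot (hinside w) h _ h1).symm

/-! ### Embedding surface groups in the shift extension -/

theorem HasSolvableWordProblem.of_mulEquiv {G H : Type*} [Group G] [Group H] (e : G ≃* H)
    (h : HasSolvableWordProblem H) : HasSolvableWordProblem G := by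
  obtain ⟨n, s, hs, hp⟩ := h
  refine ⟨n, e.symm ∘ s, ?_, hp.of_eq fun w => ?_⟩
  · rw [Set.range_comp, ← MulEquiv.coe_toMonoidHom, ← MonoidHom.map_closure, hs,
      ← MonoidHom.range_eq_map, MonoidHom.range_eq_top]
    exact e.symm.surjective
  · rw [← MulEquiv.coe_toMonoidHom, ← map_wordEval]
    simp

namespace SurfaceExtension

theorem inr_mul_inl_none {Y : Type*} (ε : ℤˣ) (r : FreeGroup Y) :
    (SemidirectProduct.inr (Multiplicative.ofAdd 1) * SemidirectProduct.inl (FreeGroup.of none) *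
      (SemidirectProduct.inr (Multiplicative.ofAdd 1))⁻¹ : SurfaceExtension ε r) =
      SemidirectProduct.inl (FreeGroup.of none) ^ (ε : ℤ) * SemidirectProduct.inl (level 0 r) := by
  rw [← map_inv, ← SemidirectProduct.inl_aut, ← map_zpow, ← map_mul, ← shift_of_none]
  simp

/-- The homomorphism from the extension to a group with elements that satisfy the relation
`q * p * q⁻¹ = p ^ ε * r`. -/
theorem exists_hom {Y G : Type*} [Group G] (ε : ℤˣ) (r : FreeGroup Y) (y : Y → G) (p q : G)
    (h : q * p * q⁻¹ = p ^ (ε : ℤ) * FreeGroup.lift y r) :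
    ∃ f : SurfaceExtension ε r →* G,
      (∀ x, f (SemidirectProduct.inl (FreeGroup.of (some (x, 0)))) = y x) ∧
      f (SemidirectProduct.inl (FreeGroup.of none)) = p ∧
      f (SemidirectProduct.inr (Multiplicative.ofAdd 1)) = q := by
  -- A letter of level `i` must be the conjugate of its level-zero letter by `q ^ i`. The hypothesis
  -- on `p` then makes the shift correspond to conjugation by `q`.
  let fn : FreeGroup (Option (Y × ℤ)) →* G :=
    FreeGroup.lift fun o => o.elim p fun x => q ^ x.2 * y x.1 * (q ^ x.2)⁻¹
  have hlevel : fn (level 0 r) = FreeGroup.lift y r := by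
    have : fn.comp (level 0) = FreeGroup.lift y := by
      ext1 x
      simp [fn, level_of]
    exact DFunLike.congr_fun this r
  have hstep : ∀ x, fn (shift ε r x) = q * fn x * q⁻¹ := by
    have : fn.comp (shift ε r).toMonoidHom = (MulAut.conj q).toMonoidHom.comp fn := by
      ext1 o
      rcases o with _ | ⟨x, i⟩
      · change fn (shift ε r (FreeGroup.of none)) = q * fn (FreeGroup.of none) * q⁻¹
        rw [shift_of_none, map_mul, map_zpow, hlevel]
        simpa [fn] using h.symm
      · change fn (shift ε r (FreeGroup.of (some (x, i)))) =
          q * fn (FreeGroup.of (some (x, i))) * q⁻¹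
        rw [shift_of_some]
        simp only [fn, FreeGroup.lift_apply_of, Option.elim_some, add_comm i 1, zpow_add, zpow_one]
        group
    exact fun x => DFunLike.congr_fun this x
  have hpow : ∀ (k : ℤ) (x), fn ((shift ε r ^ k) x) = q ^ k * fn x * (q ^ k)⁻¹ := by
    intro k
    induction k using Int.induction_on with
    | zero => simp
    | succ k ih =>
      intro x
      rw [add_comm, zpow_add, zpow_one, MulAut.mul_apply, hstep, ih, zpow_add, zpow_one]
      group
    | pred k ih =>
      intro x
      have h1 : shift ε r ((shift ε r ^ (-(k : ℤ) - 1)) x) = (shift ε r ^ (-(k : ℤ))) x := by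
        rw [← MulAut.mul_apply, ← zpow_one_add]
        congr 2
        ring
      have h2 := hstep ((shift ε r ^ (-(k : ℤ) - 1)) x)
      rw [h1, ih] at h2
      have h3 : fn ((shift ε r ^ (-(k : ℤ) - 1)) x) =
          q⁻¹ * (q ^ (-(k : ℤ)) * fn x * (q ^ (-(k : ℤ)))⁻¹) * q := by
        rw [h2]
        group
      rw [h3, zpow_sub_one q]
      group
  refine ⟨SemidirectProduct.lift fn (zpowersHom G q) fun k => ?_, fun x => ?_, ?_, ?_⟩
  · ext1 x
    exact hpow (Multiplicative.toAdd k) _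
  · simp [fn]
  · simp [fn]
  · simp

end SurfaceExtension

/-- A group with solvable word problem and, in a subgroup of finite index, unique roots. -/
def SolvableVirtualUniqueRoots (G : Type*) [Group G] : Prop :=
  HasSolvableWordProblem G ∧ VirtualUniqueRoots G

namespace SolvableVirtualUniqueRoots

variable {β : Type*}

theorem of_finite (G : Type*) [Group G] [Finite G] : SolvableVirtualUniqueRoots G :=
  ⟨HasSolvableWordProblem.of_finite G, VirtualUniqueRoots.of_finite⟩

theorem of_mulEquiv {G H : Type*} [Group G] [Group H] (e : G ≃* H)
    (h : SolvableVirtualUniqueRoots H) : SolvableVirtualUniqueRoots G :=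
  ⟨h.1.of_mulEquiv e, h.2.of_injective e.toMonoidHom e.injective⟩

theorem of_injective [Primcodable β] {ε : ℤˣ} {r : FreeGroup β} {G : Type*} [Group G]
    [Group.FG G] (f : G →* SurfaceExtension ε r) (hf : Function.Injective f) :
    SolvableVirtualUniqueRoots G :=
  ⟨SurfaceExtension.hasSolvableWordProblem_of_injective f hf,
    (SurfaceExtension.virtualUniqueRoots ε r).of_injective f hf⟩

theorem fg_presentedGroup [Finite β] (rels : Set (FreeGroup β)) :
    Group.FG (PresentedGroup rels) :=
  Group.fg_iff.2 ⟨_, PresentedGroup.closure_range_of rels, Set.finite_range _⟩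

/-- The homomorphism induced by `F` has `back` as a left inverse, as can be checked on generators.
Surjectivity is not needed, so the target may have superfluous letters. -/
theorem injective_toGroup {rel : FreeGroup β} {H : Type*} [Group H] (F : β → H)
    (hF : FreeGroup.lift F rel = 1) (back : H →* PresentedGroup {rel})
    (hback : ∀ x, back (F x) = PresentedGroup.of x) :
    ∃ f : PresentedGroup {rel} →* H, Function.Injective f := by
  have hrel : ∀ s ∈ ({rel} : Set (FreeGroup β)), FreeGroup.lift F s = 1 := by
    rintro s rfl
    exact hF
  refine ⟨PresentedGroup.toGroup hrel, Function.LeftInverse.injective (g := back) fun x => ?_⟩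
  have : back.comp (PresentedGroup.toGroup hrel) = MonoidHom.id _ := by
    refine PresentedGroup.ext fun x => ?_
    simp [hback]
  exact DFunLike.congr_fun this x

/-- A one-relator group with elements `p` and `q` such that `q * p * q⁻¹ = p ^ ε * r`, with a
map `F` of the generators that is inverted by the homomorphism from the extension. -/
theorem of_relation [Finite β] [Primcodable β] {rel : FreeGroup β} (ε : ℤˣ) (r : FreeGroup β)
    (F : β → SurfaceExtension ε r) (hF : FreeGroup.lift F rel = 1)
    (p q : PresentedGroup {rel})
    (h : q * p * q⁻¹ = p ^ (ε : ℤ) * PresentedGroup.mk {rel} r)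
    (hback : ∀ back : SurfaceExtension ε r →* PresentedGroup {rel},
      (∀ x, back (SemidirectProduct.inl (FreeGroup.of (some (x, 0)))) = PresentedGroup.of x) →
      back (SemidirectProduct.inl (FreeGroup.of none)) = p →
      back (SemidirectProduct.inr (Multiplicative.ofAdd 1)) = q →
      ∀ x, back (F x) = PresentedGroup.of x) :
    SolvableVirtualUniqueRoots (PresentedGroup {rel}) := by
  have hmk : FreeGroup.lift (PresentedGroup.of (rels := {rel})) = PresentedGroup.mk {rel} := by
    ext1 x
    simp [PresentedGroup.of]
  rw [← hmk] at h
  obtain ⟨back, h1, h2, h3⟩ := SurfaceExtension.exists_hom ε r _ p q h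
  obtain ⟨f, hf⟩ := injective_toGroup F hF back (hback back h1 h2 h3)
  have := fg_presentedGroup {rel}
  exact of_injective f hf

/-- A one-relator group of which a generator can be eliminated. -/
theorem of_elimination [Finite β] [Primcodable β] {rel : FreeGroup β} (F : β → FreeGroup β)
    (hF : FreeGroup.lift F rel = 1)
    (hback : ∀ x, PresentedGroup.mk {rel} (F x) = PresentedGroup.of x) :
    SolvableVirtualUniqueRoots (PresentedGroup {rel}) := by
  obtain ⟨f, hf⟩ := injective_toGroup F hF (PresentedGroup.mk {rel}) hback
  have := fg_presentedGroup {rel}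
  have hlevel : Function.Injective (SurfaceExtension.level (Y := β) 0) :=
    FreeGroup.map_injective fun x y h => by simpa using h
  -- The free group sits at level zero of the extension with trivial data.
  exact of_injective (ε := 1) (r := (1 : FreeGroup β))
    ((SemidirectProduct.inl.comp (SurfaceExtension.level 0)).comp f)
    ((SemidirectProduct.inl_injective.comp hlevel).comp hf)

end SolvableVirtualUniqueRoots

-- In positive genus the relator `[a₁, b₁] t` reads `q p q⁻¹ = p t⁻¹` with `p = a₁⁻¹` and `q = b₁`.
-- In genus zero the group is trivial, or `c₁` can be eliminated.
open SolvableVirtualUniqueRoots in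
theorem solvableVirtualUniqueRoots_orientable (g p : ℕ) :
    SolvableVirtualUniqueRoots (OrientableSurfaceGroup g p) := by
  rcases g with _ | g
  · rcases p with _ | p
    · have : Finite (OrientableSurfaceGroup 0 0) :=
        Finite.of_surjective _ (PresentedGroup.mk_surjective _)
      exact of_finite _
    · set t : FreeGroup ((Fin 0 ⊕ Fin 0) ⊕ Fin (p + 1)) :=
        (List.ofFn fun j : Fin p => FreeGroup.of (Sum.inr j.succ)).prod with ht
      have hrel : orientableRelator 0 (p + 1) = FreeGroup.of (Sum.inr 0) * t := by
        simp [orientableRelator, ht, List.ofFn_succ]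
      let F : (Fin 0 ⊕ Fin 0) ⊕ Fin (p + 1) → FreeGroup ((Fin 0 ⊕ Fin 0) ⊕ Fin (p + 1)) :=
        Sum.elim (fun x => FreeGroup.of (Sum.inl x))
          (Fin.cons t⁻¹ fun j => FreeGroup.of (Sum.inr j.succ))
      have hFt : FreeGroup.lift F t = t := by
        rw [ht, map_list_prod, List.map_ofFn]
        rfl
      have hone : PresentedGroup.mk {orientableRelator 0 (p + 1)}
          (FreeGroup.of (Sum.inr 0) * t) = 1 := by
        rw [← hrel]
        exact PresentedGroup.one_of_mem (Set.mem_singleton _)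
      refine of_elimination F ?_ ?_
      · rw [hrel, map_mul, hFt]
        simp [F]
      · rintro ((x | x) | j)
        · exact x.elim0
        · exact x.elim0
        · refine Fin.cases ?_ (fun j => ?_) j
          · simp only [F, Sum.elim_inr, Fin.cons_zero, map_inv]
            rw [map_mul] at hone
            exact (eq_inv_of_mul_eq_one_left hone).symm
          · simp [F, PresentedGroup.of]
  · set t : FreeGroup ((Fin (g + 1) ⊕ Fin (g + 1)) ⊕ Fin p) :=
      (List.ofFn fun i : Fin g =>
        commutatorWord (Sum.inl (Sum.inl i.succ)) (Sum.inl (Sum.inr i.succ))).prod *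
      (List.ofFn fun j : Fin p => FreeGroup.of (Sum.inr j)).prod with ht
    have hrel : orientableRelator (g + 1) p =
        commutatorWord (Sum.inl (Sum.inl 0)) (Sum.inl (Sum.inr 0)) * t := by
      simp [orientableRelator, ht, List.ofFn_succ, mul_assoc]
    have hone : PresentedGroup.mk {orientableRelator (g + 1) p}
        (commutatorWord (Sum.inl (Sum.inl 0)) (Sum.inl (Sum.inr 0)) * t) = 1 := by
      rw [← hrel]
      exact PresentedGroup.one_of_mem (Set.mem_singleton _)
    let F : (Fin (g + 1) ⊕ Fin (g + 1)) ⊕ Fin p → SurfaceExtension 1 t⁻¹ :=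
      Sum.elim
        (Sum.elim
          (Fin.cons (SemidirectProduct.inl (FreeGroup.of none))⁻¹ fun i =>
            SemidirectProduct.inl (FreeGroup.of (some (Sum.inl (Sum.inl i.succ), 0))))
          (Fin.cons (SemidirectProduct.inr (Multiplicative.ofAdd 1)) fun i =>
            SemidirectProduct.inl (FreeGroup.of (some (Sum.inl (Sum.inr i.succ), 0)))))
        fun j => SemidirectProduct.inl (FreeGroup.of (some (Sum.inr j, 0)))
    -- The word `t` avoids `a₁` and `b₁`, and on the other letters `F` is the inclusion at level
    -- zero.
    have hFt : ∀ u, u = t →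
        FreeGroup.lift F u = SemidirectProduct.inl (SurfaceExtension.level 0 u) := by
      intro u hu
      rw [← MonoidHom.comp_apply SemidirectProduct.inl, hu.trans ht, map_mul, map_mul, map_list_prod,
        map_list_prod, map_list_prod, map_list_prod, List.map_ofFn, List.map_ofFn, List.map_ofFn,
        List.map_ofFn]
      congr 3
    refine of_relation 1 t⁻¹ F ?_ (PresentedGroup.of (Sum.inl (Sum.inl 0)))⁻¹
      (PresentedGroup.of (Sum.inl (Sum.inr 0))) ?_ ?_
    · have h := SurfaceExtension.inr_mul_inl_none 1 t⁻¹
      rw [hrel, map_mul, hFt t rfl]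
      simp only [commutatorWord, map_mul, map_inv, FreeGroup.lift_apply_of, F, Sum.elim_inl,
        Sum.elim_inr, Fin.cons_zero, Units.val_one, zpow_one] at h ⊢
      rw [inv_inv, mul_assoc _ _ (SemidirectProduct.inl (FreeGroup.of none)), mul_assoc, mul_assoc,
        ← mul_assoc (_ * _), h]
      group
    · simp only [commutatorWord, map_mul, map_inv] at hone ⊢
      change PresentedGroup.of _ * PresentedGroup.of _ * (PresentedGroup.of _)⁻¹ *
        (PresentedGroup.of _)⁻¹ * _ = 1 at hone
      rw [← eq_inv_iff_mul_eq_one] at hone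
      rw [← hone]
      simp only [Units.val_one, zpow_one]
      group
    · rintro back h1 h2 h3 ((i | i) | j)
      · refine Fin.cases ?_ (fun i => ?_) i
        · simp [F, h2]
        · simp [F, h1]
      · refine Fin.cases ?_ (fun i => ?_) i
        · simp [F, h3]
        · simp [F, h1]
      · simp [F, h1]

-- With `p = d₁ d₂` and `q = d₂⁻¹` the relator `d₁² d₂² t` becomes `p (q p q⁻¹) t`, that is `q p q⁻¹
-- = p⁻¹ t⁻¹`. With a single `d₁`, the group is finite when there is no `c`, and otherwise `c₁` can
-- be eliminated.
open SolvableVirtualUniqueRoots in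
theorem solvableVirtualUniqueRoots_nonorientable {k : ℕ} (hk : 1 ≤ k) (p : ℕ) :
    SolvableVirtualUniqueRoots (NonorientableSurfaceGroup k p) := by
  obtain ⟨k, rfl⟩ := Nat.exists_eq_add_of_le' hk
  rcases k with _ | k
  · rcases p with _ | p
    · have hone : PresentedGroup.mk {nonorientableRelator 1 0}
          (FreeGroup.of (Sum.inl 0) ^ 2) = 1 := by
        have hrel : nonorientableRelator 1 0 = FreeGroup.of (Sum.inl 0) ^ 2 := by
          simp [nonorientableRelator]
        rw [← hrel]
        exact PresentedGroup.one_of_mem (Set.mem_singleton _)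
      have hfin : IsOfFinOrder (PresentedGroup.of (rels := {nonorientableRelator 1 0})
          (Sum.inl 0)) :=
        isOfFinOrder_iff_pow_eq_one.2 ⟨2, two_pos, hone⟩
      have : Finite (NonorientableSurfaceGroup (0 + 1) 0) := by
        rw [← Set.finite_univ_iff]
        refine (hfin.finite_zpowers).subset fun x _ => ?_
        refine PresentedGroup.generated_by _ _ (fun y => ?_) x
        rcases y with i | j
        · rw [Subsingleton.elim i 0]
          exact Subgroup.mem_zpowers _
        · exact j.elim0
      exact of_finite _
    · set t : FreeGroup (Fin 1 ⊕ Fin (p + 1)) :=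
        (List.ofFn fun j : Fin p => FreeGroup.of (Sum.inr j.succ)).prod with ht
      have hrel : nonorientableRelator 1 (p + 1) =
          FreeGroup.of (Sum.inl 0) ^ 2 * (FreeGroup.of (Sum.inr 0) * t) := by
        simp [nonorientableRelator, ht, List.ofFn_succ]
      let F : Fin 1 ⊕ Fin (p + 1) → FreeGroup (Fin 1 ⊕ Fin (p + 1)) :=
        Sum.elim (fun x => FreeGroup.of (Sum.inl x))
          (Fin.cons ((FreeGroup.of (Sum.inl 0) ^ 2)⁻¹ * t⁻¹)
            fun j => FreeGroup.of (Sum.inr j.succ))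
      have hFt : FreeGroup.lift F t = t := by
        rw [ht, map_list_prod, List.map_ofFn]
        rfl
      have hone : PresentedGroup.mk {nonorientableRelator 1 (p + 1)}
          (FreeGroup.of (Sum.inl 0) ^ 2 * (FreeGroup.of (Sum.inr 0) * t)) = 1 := by
        rw [← hrel]
        exact PresentedGroup.one_of_mem (Set.mem_singleton _)
      refine of_elimination F ?_ ?_
      · change FreeGroup.lift F (nonorientableRelator 1 (p + 1)) = 1
        rw [hrel, map_mul, map_mul, hFt]
        simp [F]
      · rintro (x | j)
        · rfl
        · refine Fin.cases ?_ (fun j => ?_) j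
          · simp only [F, Sum.elim_inr, Fin.cons_zero, map_mul, map_inv]
            rw [map_mul, map_mul, mul_eq_one_iff_inv_eq] at hone
            change _ = PresentedGroup.mk _ (FreeGroup.of (Sum.inr 0))
            rw [mul_inv_eq_iff_eq_mul]
            exact hone
          · rfl
  · set t : FreeGroup (Fin (k + 2) ⊕ Fin p) :=
      (List.ofFn fun i : Fin k => FreeGroup.of (Sum.inl i.succ.succ) ^ 2).prod *
      (List.ofFn fun j : Fin p => FreeGroup.of (Sum.inr j)).prod with ht
    have hrel : nonorientableRelator (k + 2) p =
        FreeGroup.of (Sum.inl 0) ^ 2 * (FreeGroup.of (Sum.inl 1) ^ 2 * t) := by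
      simp [nonorientableRelator, ht, List.ofFn_succ, mul_assoc]
    have hone : PresentedGroup.mk {nonorientableRelator (k + 2) p}
        (FreeGroup.of (Sum.inl 0) ^ 2 * (FreeGroup.of (Sum.inl 1) ^ 2 * t)) = 1 := by
      rw [← hrel]
      exact PresentedGroup.one_of_mem (Set.mem_singleton _)
    -- Solving for the generators gives `d₁ = p q` and `d₂ = q⁻¹`.
    let F : Fin (k + 2) ⊕ Fin p → SurfaceExtension (-1) t⁻¹ :=
      Sum.elim
        (Fin.cons (SemidirectProduct.inl (FreeGroup.of none) *
            SemidirectProduct.inr (Multiplicative.ofAdd 1))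
          (Fin.cons (SemidirectProduct.inr (Multiplicative.ofAdd 1))⁻¹ fun i =>
            SemidirectProduct.inl (FreeGroup.of (some (Sum.inl i.succ.succ, 0)))))
        fun j => SemidirectProduct.inl (FreeGroup.of (some (Sum.inr j, 0)))
    have hF0 : F (Sum.inl 0) = SemidirectProduct.inl (FreeGroup.of none) *
        SemidirectProduct.inr (Multiplicative.ofAdd 1) := rfl
    have hF1 : F (Sum.inl 1) = (SemidirectProduct.inr (Multiplicative.ofAdd 1))⁻¹ := rfl
    have hFi : ∀ i : Fin k, F (Sum.inl i.succ.succ) =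
        SemidirectProduct.inl (FreeGroup.of (some (Sum.inl i.succ.succ, 0))) := fun _ => rfl
    have hFj : ∀ j : Fin p, F (Sum.inr j) =
        SemidirectProduct.inl (FreeGroup.of (some (Sum.inr j, 0))) := fun _ => rfl
    have hFt : ∀ u, u = t →
        FreeGroup.lift F u = SemidirectProduct.inl (SurfaceExtension.level 0 u) := by
      intro u hu
      rw [← MonoidHom.comp_apply SemidirectProduct.inl, hu.trans ht, map_mul, map_mul, map_list_prod,
        map_list_prod, map_list_prod, map_list_prod, List.map_ofFn, List.map_ofFn, List.map_ofFn,
        List.map_ofFn]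
      congr 3
    refine of_relation (-1) t⁻¹ F ?_
      (PresentedGroup.of (Sum.inl 0) * PresentedGroup.of (Sum.inl 1))
      (PresentedGroup.of (Sum.inl 1))⁻¹ ?_ ?_
    · have h := SurfaceExtension.inr_mul_inl_none (-1) t⁻¹
      rw [map_inv, map_inv] at h
      change FreeGroup.lift F (nonorientableRelator (k + 2) p) = 1
      rw [hrel, map_mul, map_mul, map_pow, map_pow, FreeGroup.lift_apply_of,
        FreeGroup.lift_apply_of, hFt t rfl, hF0, hF1]
      have h' : SemidirectProduct.inl (FreeGroup.of none) *
          (SemidirectProduct.inr (Multiplicative.ofAdd 1) *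
            SemidirectProduct.inl (FreeGroup.of none) *
            (SemidirectProduct.inr (Multiplicative.ofAdd 1))⁻¹) *
          SemidirectProduct.inl (SurfaceExtension.level 0 t) =
          (1 : SurfaceExtension (-1) t⁻¹) := by
        rw [h]
        simp
      rw [← h']
      simp only [pow_two]
      group
    · rw [map_mul, map_mul, map_pow, map_pow] at hone
      change PresentedGroup.of _ ^ 2 * (PresentedGroup.of _ ^ 2 * _) = 1 at hone
      rw [← mul_assoc, ← eq_inv_iff_mul_eq_one] at hone
      rw [map_inv, ← hone]
      simp only [Units.val_neg, Units.val_one, pow_two]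
      group
    · rintro back h1 h2 h3 (i | j)
      · refine Fin.cases ?_ (fun i => Fin.cases ?_ (fun i => ?_) i) i
        · rw [hF0, map_mul, h2, h3, mul_inv_cancel_right]
        · change back (F (Sum.inl 1)) = _
          rw [hF1, map_inv, h3, inv_inv]
          rfl
        · rw [hFi, h1]
      · rw [hFj, h1]

theorem IsSurfaceGroup.solvableVirtualUniqueRoots {G : Type*} [Group G] (h : IsSurfaceGroup G) :
    SolvableVirtualUniqueRoots G := by
  rcases h with ⟨g, p, ⟨e⟩⟩ | ⟨k, p, hk, ⟨e⟩⟩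
  · exact (solvableVirtualUniqueRoots_orientable g p).of_mulEquiv e
  · exact (solvableVirtualUniqueRoots_nonorientable hk p).of_mulEquiv e

theorem proposition5 (Γ : Type*) [Group Γ] :
    (Group.IsFinitelyPresented Γ → HasSolvableWordProblem Γ → UniqueRootProperty Γ →
      ∀ H : Subgroup (Comm Γ), H.FG → HasSolvableWordProblem H) ∧
    (IsSurfaceGroup Γ →
      ∀ H : Subgroup (Comm Γ), H.FG → HasSolvableWordProblem H) :=
  ⟨fun _ hΓ hroot => hasSolvableWordProblem_of_subgroup_comm hΓ hroot.virtualUniqueRoots,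
    fun h => hasSolvableWordProblem_of_subgroup_comm h.solvableVirtualUniqueRoots.1
      h.solvableVirtualUniqueRoots.2⟩
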